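/- Let $n\ge 1$, let $d_1,\dots,d_n\ge 1$ be integers with $D=d_1\cdots d_n\ge 2$, and let $k\ge 0$. A state is a positive semidefinite operator of trace $1$ on $\mathbb C^{d_1}\otimes\dots\otimes\mathbb C^{d_n}$; it is (fully) separable if it is a finite convex combination of tensor products $\rho_1\otimes\dots\otimes\rho_n$ of states $\rho_i$ on $\mathbb C^{d_i}$. For Hermitian operators (observables) $A_1,\dots,A_k$ on this space let $$L(A_1,\dots,A_k)=\{(\operatorname{Tr}\rho A_1,\dots,\operatorname{Tr}\rho A_k)\in\mathbb R^k : \rho\text{ a state}\},$$ let $L_{\mathrm{SEP}}(A_1,\dots,A_k)$ be the same set with $\rho$ restricted to separable states, and let $$\mu_{n,\boldsymbol d,k}=\inf_{A_1,\dots,A_k}\frac{\operatorname{vol}L_{\mathrm{SEP}}(A_1,\dots,A_k)}{\operatorname{vol}L(A_1,\dots,A_k)},$$ the infimum being over all $k$-tuples of Hermitian operators whose traceless parts $A_j-\frac{\operatorname{Tr}A_j}{D}\mathbb 1$ are linearly independent ($\mu_{n,\boldsymbol d,k}=+\infty$ if there are none). Then $$\mu_{n,\boldsymbol d,k}\ \ge\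 \left[\frac bD\sqrt{\frac{D-1}{D-b^2}}\right]^k,\qquad b=\sqrt{\frac{D^n}{(2D-1)^{n-2}(D^2-1)+1}}.$$ For a bipartite $d\times d$ system ($n=2$, $d_1=d_2=d\ge 2$) one has moreover $$\mu_{d,k}:=\mu_{2,(d,d),k}\ \ge\ \frac1{(d^2-1)^k}.$$ The same lower bounds hold for the volume ratio of arbitrary, possibly dependent, Hermitian $A_1,\dots,A_k$, if the volumes are taken in the affine span of $L(A_1,\dots,A_k)$, with respect to the Euclidean volume of the dimension of that span. -/

import Mathlib

open MeasureTheory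
open scoped ComplexOrder

noncomputable section

namespace SepNumRange

/-- Quantum states (density matrices). -/
def states (ι : Type*) [Fintype ι] : Set (Matrix ι ι ℂ) :=
  {ρ | ρ.PosSemidef ∧ ρ.trace = 1}

/-- Index set of the standard product basis of `ℂ^{d₁} ⊗ ⋯ ⊗ ℂ^{dₙ}`. -/
abbrev Idx {n : ℕ} (d : Fin n → ℕ) : Type := ∀ i, Fin (d i)

/-- The tensor (Kronecker) product `ρ₁ ⊗ ⋯ ⊗ ρₙ`, written in the product basis. -/
def tensor {n : ℕ} {d : Fin n → ℕ} (ρ : ∀ i, Matrix (Fin (d i)) (Fin (d i)) ℂ) :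
    Matrix (Idx d) (Idx d) ℂ :=
  Matrix.of fun x y => ∏ i, ρ i (x i) (y i)

/-- Fully separable states: finite convex combinations of tensor products of local states. -/
def sepStates {n : ℕ} (d : Fin n → ℕ) : Set (Matrix (Idx d) (Idx d) ℂ) :=
  {ρ | ∃ (m : ℕ) (p : Fin m → ℝ) (σ : Fin m → ∀ i, Matrix (Fin (d i)) (Fin (d i)) ℂ),
    (∀ j, 0 ≤ p j) ∧ ∑ j, p j = 1 ∧ (∀ j i, σ j i ∈ states (Fin (d i))) ∧
    ρ = ∑ j, p j • tensor (σ j)}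

/-- The joint numerical range of `A₁, …, A_k` restricted to `X`. (For Hermitian `A j` and a state
`ρ` the trace is real, so taking the real part loses nothing.) -/
def numRange {ι : Type*} [Fintype ι] {k : ℕ} (X : Set (Matrix ι ι ℂ))
    (A : Fin k → Matrix ι ι ℂ) : Set (EuclideanSpace ℝ (Fin k)) :=
  (fun ρ => WithLp.toLp 2 fun j => (ρ * A j).trace.re) '' X

/-- Linear independence (over `ℝ`) of the traceless parts `A j - (Tr (A j) / D) 1`. -/
def Independent {ι : Type*} [Fintype ι] [DecidableEq ι] {k : ℕ}
    (A : Fin k → Matrix ι ι ℂ) : Prop :=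
  LinearIndependent ℝ fun j =>
    A j - ((A j).trace / (Fintype.card ι : ℂ)) • (1 : Matrix ι ι ℂ)

/-- `vol L_SEP(A) / vol L(A)` with the Lebesgue measure of `ℝ^k`. -/
def volRatio {n : ℕ} {d : Fin n → ℕ} {k : ℕ} (A : Fin k → Matrix (Idx d) (Idx d) ℂ) : ENNReal :=
  volume (numRange (sepStates d) A) / volume (numRange (states (Idx d)) A)

/-- `vol L_SEP(A) / vol L(A)` for observables that may be dependent: with `m` the dimension of the
affine span of `L(A)`, both sets are measured by the `m`-dimensional Euclidean volume
(`m`-dimensional Hausdorff measure, normalized to be Lebesgue measure on `ℝ^m`). -/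
def relVolRatio {n : ℕ} {d : Fin n → ℕ} {k : ℕ} (A : Fin k → Matrix (Idx d) (Idx d) ℂ) : ENNReal :=
  let m := Module.finrank ℝ (vectorSpan ℝ (numRange (states (Idx d)) A))
  μHE[m] (numRange (sepStates d) A) / μHE[m] (numRange (states (Idx d)) A)

/-- The minimal volume ratio `μ_{n,d,k}` over `k` independent observables (`⊤` if there are
none, that is, if `k > D² - 1`). -/
def minVolRatio {n : ℕ} (d : Fin n → ℕ) (k : ℕ) : ENNReal :=
  sInf {r | ∃ A : Fin k → Matrix (Idx d) (Idx d) ℂ,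
    (∀ j, (A j).IsHermitian) ∧ Independent A ∧ r = volRatio A}

/-- `b = √(D^n / ((2D-1)^{n-2} (D²-1) + 1))`. -/
def bConst (n : ℕ) (D : ℝ) : ℝ :=
  √(D ^ n / ((2 * D - 1) ^ ((n : ℤ) - 2) * (D ^ 2 - 1) + 1))

/-- The base `(b/D) √((D-1)/(D-b²))` of the lower bound. -/
def epsConst (n : ℕ) (D : ℝ) : ℝ :=
  bConst n D / D * √((D - 1) / (D - bConst n D ^ 2))

end SepNumRange

end

open scoped NNReal

noncomputable section

namespace SepNumRange

open Matrix

/-! Everything follows from one inclusion. Suppose that `(1 - ε)/D • 1 + ε • ρ` is separable for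
every state `ρ`. Then `L_SEP` contains the image of `L` under the homothety of ratio `ε` centred at
the point of the maximally mixed state. If `L` spans dimension `m ≤ k`, the volume ratio is at least
`ε ^ m ≥ ε ^ k`. Dependent observables thus need no extra argument, and for independent ones the
span is all of `ℝ^k`. By convexity `ρ` may be taken pure.

The mixtures are separable because the cone of separable operators contains a Frobenius ball around
the identity. Split off the first factor and view `1 + Δ` as a block matrix. A positive vector that
the matrix of scaled block norms does not increase distributes the identity among pairs of positions
(`one_add_mem_of_dominant`). Each pair then forms a two-by-two block operator with multiples of the
identity on the diagonal and `Y`, `Yᴴ` off it. It is separable if `(c 1, Y) = (∑ P, ∑ z P)` with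
phases `z` and separable `P`: this is what `phaseCone` records.

If the remaining factors include at most one nontrivial one, every positive `P` is separable.
Contractions are averages of unitaries, which by spectral decomposition are sums `∑ z P`, so every
radius below `1` is allowed off the diagonal. Otherwise, separating Hermitian and anti-Hermitian
parts costs a factor `√2`. Hence for `m ≥ 2` nontrivial factors every radius below `2 ^ (1 - m / 2)`
is reached (`hermBall_sepCone`). For pure states and `m ≥ 3`, the diagonal blocks, which do not pay
the `√2`, give a slight gain (`one_add_pure_mem`). The stated constant lies within these bounds by
elementary estimates in `D`. -/

/-- The square of the Frobenius norm. -/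
def frobSq {ι : Type*} [Fintype ι] (Y : Matrix ι ι ℂ) : ℝ := ∑ x, ∑ y, ‖Y x y‖ ^ 2

/-- The cone of unnormalized fully separable operators. -/
def sepCone {n : ℕ} (d : Fin n → ℕ) : Submodule ℝ≥0 (Matrix (Idx d) (Idx d) ℂ) :=
  Submodule.span ℝ≥0 {M | ∃ σ : ∀ i, Matrix (Fin (d i)) (Fin (d i)) ℂ,
    (∀ i, (σ i).PosSemidef) ∧ M = tensor σ}

/-- The cone of pairs `(∑ P, ∑ z P)` with `P` in `K` and `z` a phase. The pair `(c 1, Y)` lies in it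
when the block matrix with diagonal blocks `c 1` and off-diagonal block `Y` is separable by a
decomposition into products whose first factors are `(1, z)`. -/
def phaseCone {ι : Type*} (K : Submodule ℝ≥0 (Matrix ι ι ℂ)) :
    Submodule ℝ≥0 (Matrix ι ι ℂ × Matrix ι ι ℂ) :=
  Submodule.span ℝ≥0 {p | ∃ P ∈ K, ∃ z : ℂ, ‖z‖ = 1 ∧ p = (P, z • P)}

/-- `K` contains `c 1 + Y` for Hermitian `Y` of Frobenius norm at most `r c`. -/
def HermBall {ι : Type*} [Fintype ι] [DecidableEq ι] (K : Submodule ℝ≥0 (Matrix ι ι ℂ))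
    (r : ℝ) : Prop :=
  ∀ (c : ℝ) (Y : Matrix ι ι ℂ), 0 ≤ c → Y.IsHermitian → frobSq Y ≤ (r * c) ^ 2 → c • 1 + Y ∈ K

/-- `phaseCone K` contains `(c 1, Y)` for `Y` of Frobenius norm at most `s c`. -/
def PhaseBall {ι : Type*} [Fintype ι] [DecidableEq ι] (K : Submodule ℝ≥0 (Matrix ι ι ℂ))
    (s : ℝ) : Prop :=
  ∀ (c : ℝ) (Y : Matrix ι ι ℂ), 0 ≤ c → frobSq Y ≤ (s * c) ^ 2 → (c • 1, Y) ∈ phaseCone K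

/-! ### Cones, phases and superharmonic vectors -/

section general

variable {ι : Type*}

lemma smul_mem_of_nonneg {M : Type*} [AddCommGroup M] [Module ℝ M] (K : Submodule ℝ≥0 M) {c : ℝ}
    (hc : 0 ≤ c) {x : M} (hx : x ∈ K) : c • x ∈ K :=
   K.smul_mem (⟨c, hc⟩ : ℝ≥0) hx

lemma frobSq_nonneg [Fintype ι] (Y : Matrix ι ι ℂ) : 0 ≤ frobSq Y :=
  Finset.sum_nonneg fun _ _ => Finset.sum_nonneg fun _ _ => by positivity

lemma frobSq_smul [Fintype ι] (c : ℝ) (Y : Matrix ι ι ℂ) : frobSq (c • Y) = c ^ 2 * frobSq Y := by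
  simp only [frobSq, Matrix.smul_apply, norm_smul, mul_pow, Finset.mul_sum, Real.norm_eq_abs,
    sq_abs]

lemma eq_zero_of_frobSq_le [Fintype ι] {Y : Matrix ι ι ℂ} (h : frobSq Y ≤ 0) : Y = 0 := by
  have h0 : frobSq Y = 0 := le_antisymm h (frobSq_nonneg Y)
  ext x y
  have h1 := (Finset.sum_eq_zero_iff_of_nonneg
    (fun _ _ => Finset.sum_nonneg fun _ _ => by positivity)).1 h0 x (Finset.mem_univ x)
  have h2 := (Finset.sum_eq_zero_iff_of_nonneg (fun _ _ => by positivity)).1 h1 y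
    (Finset.mem_univ y)
  simpa using h2

lemma HermBall.one_mem [Fintype ι] [DecidableEq ι] {K : Submodule ℝ≥0 (Matrix ι ι ℂ)} {r : ℝ}
    (h : HermBall K r) : (1 : Matrix ι ι ℂ) ∈ K := by
  have := h 1 0 zero_le_one Matrix.isHermitian_zero (by simp [frobSq]; positivity)
  simpa using this

lemma HermBall.mono [Fintype ι] [DecidableEq ι] {K : Submodule ℝ≥0 (Matrix ι ι ℂ)} {r r' : ℝ}
    (h : HermBall K r) (hr' : 0 ≤ r') (hr : r' ≤ r) : HermBall K r' := fun c Y hc hY hf =>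
  h c Y hc hY (hf.trans (by gcongr))

/-- The Hermitian and the anti-Hermitian part of a matrix share its Frobenius norm. -/
lemma frobSq_parts [Fintype ι] (Y : Matrix ι ι ℂ) :
    frobSq ((1 / 2 : ℝ) • (Y + Yᴴ)) + frobSq ((-Complex.I / 2) • (Y - Yᴴ)) = frobSq Y := by
  have h1 : frobSq Yᴴ = frobSq Y := by
    unfold frobSq
    rw [Finset.sum_comm]
    simp [Matrix.conjTranspose_apply]
  have key : frobSq ((1 / 2 : ℝ) • (Y + Yᴴ)) + frobSq ((-Complex.I / 2) • (Y - Yᴴ))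
      = (frobSq Y + frobSq Yᴴ) / 2 := by
    unfold frobSq
    rw [← Finset.sum_add_distrib, ← Finset.sum_add_distrib, Finset.sum_div]
    refine Finset.sum_congr rfl fun x _ => ?_
    rw [← Finset.sum_add_distrib, ← Finset.sum_add_distrib, Finset.sum_div]
    refine Finset.sum_congr rfl fun y _ => ?_
    simp only [Matrix.smul_apply, Matrix.add_apply, Matrix.sub_apply, norm_smul, mul_pow]
    have := parallelogram_law_with_norm ℝ (Y x y) (Yᴴ x y)
    have h2 : ‖(1 / 2 : ℝ)‖ ^ 2 = 1 / 4 := by norm_num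
    have h3 : ‖(-Complex.I / 2 : ℂ)‖ ^ 2 = 1 / 4 := by norm_num
    rw [h2, h3]
    linarith
  rw [key, h1]; ring

lemma phaseCone_mem {K : Submodule ℝ≥0 (Matrix ι ι ℂ)} {P : Matrix ι ι ℂ} (hP : P ∈ K) {z : ℂ}
    (hz : ‖z‖ = 1) : (P, z • P) ∈ phaseCone K :=
  Submodule.subset_span ⟨P, hP, z, hz, rfl⟩

/-- Antipodal phases realize `(c 1, z Y)` as soon as `c 1 ± Y` lies in `K`. -/
lemma phaseCone_pair {K : Submodule ℝ≥0 (Matrix ι ι ℂ)} {C Y : Matrix ι ι ℂ} (h1 : C + Y ∈ K)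
    (h2 : C + -Y ∈ K) {z : ℂ} (hz : ‖z‖ = 1) : (C, z • Y) ∈ phaseCone K := by
  have h3 := smul_mem_of_nonneg _ (by norm_num : (0 : ℝ) ≤ 1 / 2)
    ((phaseCone K).add_mem (phaseCone_mem h1 hz)
      (phaseCone_mem h2 (z := -z) (by simpa using hz)))
  convert h3 using 1
  ext x y
  · simp; ring
  · simp; ring

/-- Write `Y = A + i B` with `A`, `B` Hermitian. The phases `±1` produce `A` and `±i` produce `B`,
using `(‖A‖ + ‖B‖) / r` of the identity. Since `‖A‖² + ‖B‖² = ‖Y‖²`, this is at most `√2 ‖Y‖ / r`;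
the rest of the identity is paired with `0`. -/
lemma HermBall.phaseBall [Fintype ι] [DecidableEq ι] {K : Submodule ℝ≥0 (Matrix ι ι ℂ)} {r : ℝ}
    (hr : 0 < r) (h : HermBall K r) : PhaseBall K (r / √2) := by
  intro c Y hc hY
  set A := (1 / 2 : ℝ) • (Y + Yᴴ) with hA
  set B := (-Complex.I / 2) • (Y - Yᴴ) with hB
  have hAB : A + Complex.I • B = Y := by
    rw [hA, hB, smul_smul]
    have : Complex.I * (-Complex.I / 2) = 1 / 2 := by
      linear_combination (-1 / 2) * Complex.I_mul_I
    rw [this]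
    ext x y
    simp
    ring
  have hAh : A.IsHermitian := by
    ext x y
    simp [hA, Matrix.conjTranspose_apply, add_comm]
  have hBh : B.IsHermitian := by
    ext x y
    simp [hB, Matrix.conjTranspose_apply]
    ring
  have hs := frobSq_parts Y
  rw [← hA, ← hB] at hs
  have hA0 := frobSq_nonneg A
  have hB0 := frobSq_nonneg B
  set a := √(frobSq A) with ha
  set b := √(frobSq B) with hb
  have ha2 : a ^ 2 = frobSq A := Real.sq_sqrt hA0
  have hb2 : b ^ 2 = frobSq B := Real.sq_sqrt hB0
  have ha0 : 0 ≤ a := Real.sqrt_nonneg _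
  have hb0 : 0 ≤ b := Real.sqrt_nonneg _
  have hneg : ∀ Z : Matrix ι ι ℂ, frobSq (-Z) = frobSq Z := fun Z => by simp [frobSq]
  have hmA : (((a / r) : ℝ) • (1 : Matrix ι ι ℂ), (1 : ℂ) • A) ∈ phaseCone K := by
    refine phaseCone_pair (h _ _ (by positivity) hAh ?_) (h _ _ (by positivity) hAh.neg ?_)
      (by simp)
    · rw [mul_div_cancel₀ _ hr.ne', ha2]
    · rw [mul_div_cancel₀ _ hr.ne', ha2, hneg]
  have hmB : (((b / r) : ℝ) • (1 : Matrix ι ι ℂ), Complex.I • B) ∈ phaseCone K := by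
    refine phaseCone_pair (h _ _ (by positivity) hBh ?_) (h _ _ (by positivity) hBh.neg ?_)
      (by simp)
    · rw [mul_div_cancel₀ _ hr.ne', hb2]
    · rw [mul_div_cancel₀ _ hr.ne', hb2, hneg]
  have hle : a / r + b / r ≤ c := by
    rw [← add_div, div_le_iff₀ hr]
    refine abs_le_of_sq_le_sq' ?_ (by positivity) |>.2
    have h2 : (r / √2 * c) ^ 2 = (c * r) ^ 2 / 2 := by
      rw [mul_pow, div_pow, Real.sq_sqrt (by norm_num)]; ring
    nlinarith [sq_nonneg (a - b)]
  have hm0 : ((c - (a / r + b / r)) • (1 : Matrix ι ι ℂ), (1 : ℂ) • (0 : Matrix ι ι ℂ))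
      ∈ phaseCone K := by
    have h1 := smul_mem_of_nonneg K (sub_nonneg.2 hle) h.one_mem
    exact phaseCone_pair (by simpa using h1) (by simpa using h1) (by simp)
  have := (phaseCone K).add_mem ((phaseCone K).add_mem hmA hmB) hm0
  convert this using 1
  simp only [Prod.mk_add_mk, one_smul, add_zero, hAB, ← add_smul]
  congr 2
  ring

/-- A nonnegative matrix of Frobenius norm less than one has a positive superharmonic vector. -/
lemma exists_pos_superharmonic {m : Type*} [Fintype m] (N : m → m → ℝ)
    (hN : ∀ i j, 0 ≤ N i j) (h : ∑ i, ∑ j, N i j ^ 2 < 1) :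
    ∃ t : m → ℝ, (∀ i, 0 < t i) ∧ ∀ i, ∑ j, N i j * t j ≤ t i := by
  classical
  let _ := Matrix.frobeniusNormedRing (m := m) (α := ℝ)
  let _ := Matrix.frobeniusNormedAlgebra (m := m) (R := ℝ) (α := ℝ)
  set A : Matrix m m ℝ := Matrix.of N with hA
  have hn : ‖A‖ < 1 := by
    rw [Matrix.frobenius_norm_def]
    have h0 : (0 : ℝ) ≤ ∑ i, ∑ j, N i j ^ 2 :=
      Finset.sum_nonneg fun _ _ => Finset.sum_nonneg fun _ _ => by positivity
    have : ∑ i, ∑ j, ‖A i j‖ ^ (2 : ℝ) = ∑ i, ∑ j, N i j ^ 2 := by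
      simp [hA]
    rw [this]
    exact Real.rpow_lt_one h0 h (by norm_num)
  have hs := summable_geometric_of_norm_lt_one hn
  have hpow : ∀ (k : ℕ) (i j : m), 0 ≤ (A ^ k) i j := by
    intro k
    induction k with
    | zero => intro i j; rw [pow_zero, Matrix.one_apply]; split_ifs <;> norm_num
    | succ k ih =>
      intro i j
      rw [pow_succ, Matrix.mul_apply]
      exact Finset.sum_nonneg fun l _ => mul_nonneg (ih i l) (hN l j)
  -- `S` is the Neumann series of `(1 - N)⁻¹`. Its row sums `t` satisfy `t = 1 + N t`, so `t` is
  -- positive and dominates `N t`.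
  obtain ⟨S, hS0, hmul⟩ : ∃ S : Matrix m m ℝ, (∀ i j, 0 ≤ S i j) ∧ S = 1 + A * S := by
    refine ⟨∑' k, A ^ k, fun i j => ?_, ?_⟩
    · have h1 : HasSum (fun k => (A ^ k) i j) ((∑' k, A ^ k : Matrix m m ℝ) i j) :=
        (Pi.hasSum.1 ((Pi.hasSum.1 hs.hasSum) i)) j
      exact h1.nonneg fun k => hpow k i j
    · have h1 := mul_neg_geom_series A hn
      rw [sub_mul, one_mul] at h1
      exact sub_eq_iff_eq_add.1 h1
  have ht : ∀ i, ∑ j, S i j = 1 + ∑ j, N i j * ∑ l, S j l := by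
    intro i
    have : ∀ l, S i l = (1 : Matrix m m ℝ) i l + ∑ j, N i j * S j l := by
      intro l
      conv_lhs => rw [hmul]
      rw [Matrix.add_apply, Matrix.mul_apply]; rfl
    rw [Finset.sum_congr rfl fun l _ => this l, Finset.sum_add_distrib, Finset.sum_comm]
    simp [Matrix.one_apply, Finset.mul_sum]
  refine ⟨fun i => ∑ j, S i j, fun i => ?_, fun i => ?_⟩
  · have hi := ht i
    have : 0 ≤ ∑ j, N i j * ∑ l, S j l := Finset.sum_nonneg fun j _ =>
      mul_nonneg (hN i j) (Finset.sum_nonneg fun l _ => hS0 j l)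
    simp only [hi]
    linarith
  · have hi := ht i
    simp only
    linarith

end general

/-! ### Block decomposition along the first tensor factor -/

section blocks

variable {n : ℕ} {d : Fin (n + 1) → ℕ}

/-- The dimensions of all factors but the first. -/
abbrev tailDims (d : Fin (n + 1) → ℕ) : Fin n → ℕ := fun i => d i.succ

/-- The tensor product of an operator on the first factor with one on the remaining factors. -/
def headTensor (P : Matrix (Fin (d 0)) (Fin (d 0)) ℂ)
    (S : Matrix (Idx (tailDims d)) (Idx (tailDims d)) ℂ) : Matrix (Idx d) (Idx d) ℂ :=
  Matrix.of fun x y => P (x 0) (y 0) * S (Fin.tail x) (Fin.tail y)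

/-- The block of an operator at the position `(i, j)` of the first factor. -/
def block (Δ : Matrix (Idx d) (Idx d) ℂ) (i j : Fin (d 0)) :
    Matrix (Idx (tailDims d)) (Idx (tailDims d)) ℂ :=
  Matrix.of fun x y => Δ (Fin.cons i x) (Fin.cons j y)

lemma headTensor_add (P : Matrix (Fin (d 0)) (Fin (d 0)) ℂ)
    (S T : Matrix (Idx (tailDims d)) (Idx (tailDims d)) ℂ) :
    headTensor P (S + T) = headTensor P S + headTensor P T := by
  ext x y; simp [headTensor, mul_add]

lemma headTensor_zero (P : Matrix (Fin (d 0)) (Fin (d 0)) ℂ) :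
    headTensor (d := d) P 0 = 0 := by
  ext x y; simp [headTensor]

lemma headTensor_smul (c : ℝ) (P : Matrix (Fin (d 0)) (Fin (d 0)) ℂ)
    (S : Matrix (Idx (tailDims d)) (Idx (tailDims d)) ℂ) :
    headTensor P (c • S) = c • headTensor P S := by
  ext x y; simp [headTensor]; ring

lemma headTensor_mem {P : Matrix (Fin (d 0)) (Fin (d 0)) ℂ} (hP : P.PosSemidef)
    {S : Matrix (Idx (tailDims d)) (Idx (tailDims d)) ℂ} (hS : S ∈ sepCone (tailDims d)) :
    headTensor P S ∈ sepCone d := by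
  induction hS using Submodule.span_induction with
  | mem S hS =>
    obtain ⟨σ, hσ, rfl⟩ := hS
    refine Submodule.subset_span ⟨Fin.cons P σ, fun i => ?_, ?_⟩
    · refine Fin.cases ?_ (fun i => ?_) i
      · exact hP
      · exact hσ i
    · ext x y
      simp only [headTensor, tensor, Matrix.of_apply, Fin.prod_univ_succ]
      rfl
  | zero => rw [headTensor_zero]; exact Submodule.zero_mem _
  | add S T _ _ hS hT => rw [headTensor_add]; exact Submodule.add_mem _ hS hT
  | smul c S _ hS =>
    rw [NNReal.smul_def, headTensor_smul]
    exact smul_mem_of_nonneg _ c.2 hS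

lemma isHermitian_of_mem_sepCone {m : ℕ} {e : Fin m → ℕ} {S : Matrix (Idx e) (Idx e) ℂ}
    (hS : S ∈ sepCone e) : S.IsHermitian := by
  induction hS using Submodule.span_induction with
  | mem S hS =>
    obtain ⟨σ, hσ, rfl⟩ := hS
    ext x y
    simp only [tensor, Matrix.conjTranspose_apply, Matrix.of_apply, star_prod]
    exact Finset.prod_congr rfl fun i _ => (hσ i).1.apply _ _
  | zero => exact Matrix.isHermitian_zero
  | add S T _ _ hS hT => exact hS.add hT
  | smul c S _ hS =>
    rw [NNReal.smul_def]
    ext x y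
    simp [Matrix.conjTranspose_apply, ← hS.apply x y]

/-- For a generator `(P, z P)` the operator is the single product `w w* ⊗ P` with `w` supported on
`{i, j}`; additivity does the rest. The free parameter `a` moves weight between the two diagonal
positions. -/
lemma pair_mem {S Y : Matrix (Idx (tailDims d)) (Idx (tailDims d)) ℂ}
    (h : (S, Y) ∈ phaseCone (sepCone (tailDims d))) {i j : Fin (d 0)} (hij : i ≠ j) {a : ℝ}
    (ha : 0 < a) :
    headTensor (single i i 1) (a • S) + headTensor (single j j 1) (a⁻¹ • S)
      + headTensor (single i j 1) Y + headTensor (single j i 1) Yᴴ ∈ sepCone d := by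
  have key : ∀ p ∈ phaseCone (sepCone (tailDims d)),
      headTensor (d := d) (single i i 1) (a • p.1) + headTensor (single j j 1) (a⁻¹ • p.1)
      + headTensor (single i j 1) p.2 + headTensor (single j i 1) p.2ᴴ ∈ sepCone d := by
    intro p hp
    induction hp using Submodule.span_induction with
    | mem p hp =>
      obtain ⟨P, hP, z, hz, rfl⟩ := hp
      have hPh := isHermitian_of_mem_sepCone hP
      have hzz : z * star z = 1 := by
        rw [Complex.star_def, Complex.mul_conj, Complex.normSq_eq_norm_sq, hz]; norm_num
      -- The moduli `√a`, `1/√a` give the diagonal entries `a`, `a⁻¹` of `w w*`; the conjugate phase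
      -- at `j` gives `z` at `(i, j)`.
      set w : Fin (d 0) → ℂ := Pi.single i ((√a : ℝ) : ℂ) + Pi.single j (star z * ((√a : ℝ) : ℂ)⁻¹)
        with hw
      have hsa : ((√a : ℝ) : ℂ) ≠ 0 := by
        exact_mod_cast (Real.sqrt_pos.2 ha).ne'
      have hsa2 : ((√a : ℝ) : ℂ) * ((√a : ℝ) : ℂ) = a := by
        exact_mod_cast Real.mul_self_sqrt ha.le
      have hwi : w i = ((√a : ℝ) : ℂ) := by simp [hw, hij]
      have hwj : w j = star z * ((√a : ℝ) : ℂ)⁻¹ := by simp [hw, hij.symm]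
      have hmem := headTensor_mem (d := d) (posSemidef_vecMulVec_self_star w) hP
      convert hmem using 1
      have hvec : vecMulVec w (star w) = (a : ℂ) • single i i 1 + (a : ℂ)⁻¹ • single j j 1
          + z • single i j 1 + star z • single j i 1 := by
        have h0 : ∀ x, x ≠ i → x ≠ j → w x = 0 := fun x h1 h2 => by simp [hw, h1, h2]
        have hii : w i * star (w i) = a := by
          rw [hwi, Complex.star_def, Complex.conj_ofReal, hsa2]
        have hjj : w j * star (w j) = (a : ℂ)⁻¹ := by
          rw [hwj, ← hsa2]
          simp only [star_mul', star_star, star_inv₀, mul_inv]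
          rw [Complex.star_def, Complex.conj_ofReal]
          rw [Complex.star_def] at hzz
          linear_combination (((√a : ℝ) : ℂ)⁻¹) ^ 2 * hzz
        have hij' : w i * star (w j) = z := by
          rw [hwi, hwj]
          simp only [star_mul', star_star, star_inv₀]
          rw [Complex.star_def, Complex.conj_ofReal]
          field_simp
        have hji' : w j * star (w i) = star z := by
          rw [← hij', star_mul', star_star, mul_comm]
        ext x y
        simp only [vecMulVec_apply, Pi.star_apply, Matrix.add_apply, Matrix.smul_apply,
          Matrix.single_apply, smul_eq_mul]
        by_cases hxi : x = i
        · subst hxi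
          by_cases hyi : y = x
          · subst hyi; simpa [hij.symm] using hii
          · by_cases hyj : y = j
            · subst hyj; simpa [hij.symm, hij] using hij'
            · simp [h0 y hyi hyj, hij.symm, Ne.symm hyi, Ne.symm hyj]
        · by_cases hxj : x = j
          · subst hxj
            by_cases hyi : y = i
            · subst hyi; simpa [hij.symm, hij] using hji'
            · by_cases hyj : y = x
              · subst hyj; simpa [hij] using hjj
              · simp [h0 y hyi hyj, Ne.symm hyi, Ne.symm hyj]
          · simp [h0 x hxi hxj, Ne.symm hxi, Ne.symm hxj]
      rw [hvec]
      ext x y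
      simp only [headTensor, Matrix.add_apply, Matrix.of_apply, Matrix.smul_apply,
        Matrix.conjTranspose_apply, smul_eq_mul, star_mul', Complex.real_smul, hPh.apply,
        Complex.ofReal_inv]
      ring
    | zero => simp [headTensor_zero]
    | add p q _ _ hp hq =>
      convert Submodule.add_mem _ hp hq using 1
      simp only [Prod.fst_add, Prod.snd_add, smul_add, headTensor_add, Matrix.conjTranspose_add]
      abel
    | smul c p _ hp =>
      convert Submodule.smul_mem _ c hp using 1
      ext x y
      simp only [NNReal.smul_def, headTensor, Matrix.add_apply, Matrix.of_apply, Matrix.smul_apply,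
        Matrix.conjTranspose_apply, Complex.real_smul, Prod.smul_fst, Prod.smul_snd,
        star_mul', Complex.star_def, Complex.conj_ofReal]
      ring
  exact key (S, Y) h

lemma sum_headTensor_block (Δ : Matrix (Idx d) (Idx d) ℂ) :
    ∑ i, ∑ j, headTensor (single i j 1) (block Δ i j) = Δ := by
  ext x y
  simp only [Matrix.sum_apply, headTensor, block, Matrix.of_apply, Matrix.single_apply]
  rw [Finset.sum_eq_single (x 0), Finset.sum_eq_single (y 0)]
  · simp [Fin.cons_self_tail]
  · intro j _ hj; simp [hj]
  · simp
  · intro i _ hi; simp [hi]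
  · simp

lemma block_one_same (i : Fin (d 0)) : block (d := d) 1 i i = 1 := by
  ext x y
  simp [block, Matrix.one_apply]

lemma block_one_ne {i j : Fin (d 0)} (h : i ≠ j) : block (d := d) 1 i j = 0 := by
  ext x y
  simp only [block, Matrix.of_apply, Matrix.zero_apply]
  refine Matrix.one_apply_ne fun h' => h ?_
  have := congrFun h' 0
  simpa using this

lemma block_add (A B : Matrix (Idx d) (Idx d) ℂ) (i j : Fin (d 0)) :
    block (A + B) i j = block A i j + block B i j := rfl

lemma block_conjTranspose {Δ : Matrix (Idx d) (Idx d) ℂ} (h : Δ.IsHermitian) (i j : Fin (d 0)) :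
    (block Δ i j)ᴴ = block Δ j i := by
  ext x y
  simp [block, Matrix.conjTranspose_apply, ← h.apply (Fin.cons j x)]

lemma sum_idx_succ (f : Idx d → ℝ) :
    ∑ x, f x = ∑ i, ∑ x : Idx (tailDims d), f (Fin.cons i x) := by
  rw [← Fintype.sum_prod_type']
  exact ((Fin.consEquiv fun i => Fin (d i)).sum_comp f).symm

lemma frobSq_eq_sum_block (Δ : Matrix (Idx d) (Idx d) ℂ) :
    frobSq Δ = ∑ i, ∑ j, frobSq (block Δ i j) := by
  unfold frobSq
  rw [sum_idx_succ]
  refine Finset.sum_congr rfl fun i _ => ?_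
  refine (Finset.sum_congr rfl fun x _ => sum_idx_succ _).trans ?_
  rw [Finset.sum_comm]
  rfl

/-- Weighted diagonal dominance criterion for separability. -/
lemma one_add_mem_of_dominant {Δ : Matrix (Idx d) (Idx d) ℂ} (hΔ : Δ.IsHermitian)
    {N : Fin (d 0) → Fin (d 0) → ℝ} {t : Fin (d 0) → ℝ} (ht : ∀ i, 0 < t i)
    (hN : ∀ i, ∑ j, N i j * t j ≤ t i) (hsymm : ∀ i j, N i j = N j i)
    (hone : 1 ∈ sepCone (tailDims d))
    (hoff : ∀ i j, i ≠ j → (N i j • 1, block Δ i j) ∈ phaseCone (sepCone (tailDims d)))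
    (hdiag : ∀ i, N i i • 1 + block Δ i i ∈ sepCone (tailDims d)) : 1 + Δ ∈ sepCone d := by
  have hE : ∀ i : Fin (d 0), (single i i (1 : ℂ)).PosSemidef := fun i => by
    rw [← diagonal_single]
    exact PosSemidef.diagonal (Pi.single_nonneg.2 zero_le_one)
  -- The pair `{i, j}` takes the share `N i j * t j / t i` of the identity at position `i`, and
  -- these shares sum to at most one by superharmonicity. For `i = j` the expression is twice the
  -- diagonal term, so that half the sum over ordered pairs is correct throughout.
  have hpair : ∀ i j,
      headTensor (single i i 1) ((t j / t i) • (N i j • 1 : Matrix _ _ ℂ))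
      + headTensor (single j j 1) ((t i / t j) • (N i j • 1 : Matrix _ _ ℂ))
      + headTensor (single i j 1) (block Δ i j) + headTensor (single j i 1) (block Δ j i)
        ∈ sepCone d := by
    intro i j
    by_cases hij : i = j
    · subst hij
      have h1 := headTensor_mem (hE i) (hdiag i)
      convert Submodule.add_mem _ h1 h1 using 1
      rw [div_self (ht i).ne', one_smul, headTensor_add]
      abel
    · have := pair_mem (hoff i j hij) hij (div_pos (ht j) (ht i))
      rwa [inv_div, block_conjTranspose hΔ] at this
  have hrem : ∀ i, headTensor (single i i 1)
      ((1 - ∑ j, N i j * t j / t i) • (1 : Matrix _ _ ℂ)) ∈ sepCone d := fun i => by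
    refine headTensor_mem (hE i) (smul_mem_of_nonneg _ ?_ hone)
    rw [← Finset.sum_div, sub_nonneg, div_le_one (ht i)]
    exact hN i
  have hsum := Submodule.add_mem _ (smul_mem_of_nonneg _ (by norm_num : (0 : ℝ) ≤ 1 / 2)
    (Submodule.sum_mem _ fun i (_ : i ∈ Finset.univ) =>
      Submodule.sum_mem _ fun j (_ : j ∈ Finset.univ) => hpair i j))
    (Submodule.sum_mem _ fun i (_ : i ∈ Finset.univ) => hrem i)
  convert hsum using 1
  simp only [Finset.sum_add_distrib]
  rw [Finset.sum_comm (f := fun i j => headTensor (single j i 1) (block Δ j i)),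
    Finset.sum_comm (f := fun i j => headTensor (single j j 1)
      ((t i / t j) • (N i j • 1 : Matrix (Idx (tailDims d)) (Idx (tailDims d)) ℂ))),
    sum_headTensor_block]
  simp only [headTensor_smul]
  have h1 : ∀ i : Fin (d 0), ∑ j, (t j / t i) • N i j • headTensor (d := d) (single i i 1) 1
      = (∑ j, N i j * t j / t i) • headTensor (d := d) (single i i 1) 1 := fun i => by
    rw [Finset.sum_smul]
    refine Finset.sum_congr rfl fun j _ => ?_
    rw [smul_smul]; congr 1; ring
  have h2 : ∀ i : Fin (d 0), ∑ j, (t j / t i) • N j i • headTensor (d := d) (single i i 1) 1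
      = (∑ j, N i j * t j / t i) • headTensor (d := d) (single i i 1) 1 := fun i => by
    rw [← h1]
    exact Finset.sum_congr rfl fun j _ => by rw [hsymm]
  have h3 : (1 : Matrix (Idx d) (Idx d) ℂ) = ∑ i, headTensor (single i i 1) 1 := by
    conv_lhs => rw [← sum_headTensor_block (1 : Matrix (Idx d) (Idx d) ℂ)]
    refine Finset.sum_congr rfl fun i _ => ?_
    rw [Finset.sum_eq_single i]
    · rw [block_one_same]
    · intro j _ hj; rw [block_one_ne hj.symm, headTensor_zero]
    · simp
  simp only [h1, h2, sub_smul, one_smul, Finset.sum_sub_distrib, ← h3]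
  module

/-- A weighted Frobenius ball of separable operators around the identity, from balls for the
remaining factors. -/
lemma one_add_mem_of_weighted {Δ : Matrix (Idx d) (Idx d) ℂ} (hΔ : Δ.IsHermitian) {r s : ℝ}
    (hr : 0 < r) (hs : 0 < s) (hH : HermBall (sepCone (tailDims d)) r)
    (hP : PhaseBall (sepCone (tailDims d)) s)
    (h : ∑ i, ∑ j, frobSq (block Δ i j) / (if i = j then r else s) ^ 2 < 1) :
    1 + Δ ∈ sepCone d := by
  set N : Fin (d 0) → Fin (d 0) → ℝ := fun i j => √(frobSq (block Δ i j)) / (if i = j then r else s)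
    with hN
  have hw : ∀ i j : Fin (d 0), 0 < (if i = j then r else s) := fun i j => by split_ifs <;> assumption
  have hN0 : ∀ i j, 0 ≤ N i j := fun i j => div_nonneg (Real.sqrt_nonneg _) (hw i j).le
  have hNsq : ∀ i j, N i j ^ 2 = frobSq (block Δ i j) / (if i = j then r else s) ^ 2 := fun i j => by
    rw [hN]; simp only; rw [div_pow, Real.sq_sqrt (frobSq_nonneg _)]
  obtain ⟨t, ht, htN⟩ := exists_pos_superharmonic N hN0 (by simpa only [hNsq] using h)
  have hfs : ∀ i j, frobSq (block Δ i j) = frobSq (block Δ j i) := fun i j => by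
    rw [← block_conjTranspose hΔ]
    unfold frobSq
    rw [Finset.sum_comm]
    simp [Matrix.conjTranspose_apply]
  refine one_add_mem_of_dominant hΔ ht htN (fun i j => ?_) hH.one_mem (fun i j hij => ?_)
    fun i => ?_
  · simp only [hN, hfs i j, eq_comm]
  · refine hP _ _ (hN0 i j) (le_of_eq ?_)
    rw [mul_pow, hNsq, if_neg hij]
    field_simp
  · refine hH _ _ (hN0 i i) ?_ (le_of_eq ?_)
    · exact block_conjTranspose hΔ i i
    · rw [mul_pow, hNsq, if_pos rfl]
      field_simp

end blocks

/-! ### Balls for a cone containing all positive operators -/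

section contraction

open scoped Matrix.Norms.L2Operator MatrixOrder

variable {ι : Type*} [Fintype ι] [DecidableEq ι]

lemma l2_opNorm_le_sqrt_frobSq (Y : Matrix ι ι ℂ) : ‖Y‖ ≤ √(frobSq Y) := by
  rw [Matrix.l2_opNorm_def]
  refine ContinuousLinearMap.opNorm_le_bound _ (Real.sqrt_nonneg _) fun v => ?_
  rw [EuclideanSpace.norm_eq, EuclideanSpace.norm_eq, ← Real.sqrt_mul (frobSq_nonneg Y)]
  refine Real.sqrt_le_sqrt ?_
  rw [frobSq, Finset.sum_mul]
  refine Finset.sum_le_sum fun x _ => ?_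
  have h1 : ‖∑ y, Y x y * v y‖ ≤ ∑ y, ‖Y x y‖ * ‖v y‖ :=
    (norm_sum_le _ _).trans (le_of_eq (by simp))
  calc _ = ‖∑ y, Y x y * v y‖ ^ 2 := rfl
    _ ≤ (∑ y, ‖Y x y‖ * ‖v y‖) ^ 2 := by gcongr
    _ ≤ _ := Finset.sum_mul_sq_le_sq_mul_sq _ _ _

/-- A cone containing all positive semidefinite matrices. -/
def ContainsPosSemidef (K : Submodule ℝ≥0 (Matrix ι ι ℂ)) : Prop :=
  ∀ M : Matrix ι ι ℂ, M.PosSemidef → M ∈ K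

variable {K : Submodule ℝ≥0 (Matrix ι ι ℂ)}

lemma ContainsPosSemidef.hermBall (hK : ContainsPosSemidef K) : HermBall K 1 := by
  intro c Y hc hY hf
  refine hK _ (Matrix.nonneg_iff_posSemidef.1 ?_)
  have h1 : ‖Y‖ ≤ c := by
    refine (l2_opNorm_le_sqrt_frobSq Y).trans (Real.sqrt_le_iff.2 ⟨hc, by simpa using hf⟩)
  have h2 : -algebraMap ℝ (Matrix ι ι ℂ) ‖Y‖ ≤ Y :=
    IsSelfAdjoint.neg_algebraMap_norm_le_self (a := Y) hY
  have h3 : algebraMap ℝ (Matrix ι ι ℂ) ‖Y‖ ≤ algebraMap ℝ (Matrix ι ι ℂ) c :=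
    algebraMap_mono _ h1
  rw [Algebra.algebraMap_eq_smul_one, Algebra.algebraMap_eq_smul_one] at h3
  rw [Algebra.algebraMap_eq_smul_one] at h2
  calc (0 : Matrix ι ι ℂ) = c • 1 + -(c • 1) := by simp
    _ ≤ c • 1 + Y := by gcongr; exact (neg_le_neg h3).trans h2

/-- The spectral projections of `U` sum to `1`, and weighted with the eigenvalues, which are phases,
they sum to `U`. They are obtained as indicator functions of the eigenvalues, continuous because the
spectrum is finite. -/
lemma ContainsPosSemidef.unitary_mem (hK : ContainsPosSemidef K) {U : Matrix ι ι ℂ}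
    (hU : U ∈ unitary (Matrix ι ι ℂ)) : (1, U) ∈ phaseCone K := by
  have hn : IsStarNormal U := ⟨by rw [commute_iff_eq, hU.1, hU.2]⟩
  have hfin := Matrix.finite_spectrum U
  set s := hfin.toFinset with hs
  have hcont : ∀ f : ℂ → ℂ, ContinuousOn f (spectrum ℂ U) := fun f => hfin.continuousOn f
  set P : ℂ → Matrix ι ι ℂ := fun l => cfc (fun z : ℂ => if z = l then 1 else 0) U with hP
  have hPpos : ∀ l, P l ∈ K := fun l => by
    refine hK _ (Matrix.nonneg_iff_posSemidef.1 (cfc_nonneg fun x _ => ?_))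
    split_ifs <;> simp
  have h1 : ∑ l ∈ s, P l = 1 := by
    rw [hP, ← cfc_sum _ _ _ (fun l _ => hcont _), ← cfc_one ℂ U]
    refine cfc_congr fun z hz => ?_
    have : z ∈ s := hfin.mem_toFinset.2 hz
    simp [Finset.sum_apply, this]
  have h2 : ∑ l ∈ s, l • P l = U := by
    have : ∀ l, l • P l = cfc (fun z : ℂ => l * if z = l then 1 else 0) U := fun l =>
      (cfc_const_mul l _ U (hcont _)).symm
    simp only [this]
    rw [← cfc_sum _ _ _ (fun l _ => hcont _)]
    conv_rhs => rw [← cfc_id ℂ U]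
    refine cfc_congr fun z hz => ?_
    have : z ∈ s := hfin.mem_toFinset.2 hz
    simp [Finset.sum_apply, this]
  have h3 : ∑ l ∈ s, (P l, l • P l) ∈ phaseCone K := Submodule.sum_mem _ fun l hl =>
    phaseCone_mem (hPpos l) (by
      have := spectrum.subset_circle_of_unitary hU (hfin.mem_toFinset.1 hl)
      simpa using this)
  convert h3 using 1
  refine Prod.ext ?_ ?_
  · rw [Prod.fst_sum, ← h1]
  · rw [Prod.snd_sum]; exact h2.symm

/-- Polar decomposition gives `Y = V A` with `V` unitary and `A = |Y|`. The contraction `A` is the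
average of the unitary `W = A + i √(1 - A²)` and its adjoint, so `Y` is the average of `V W` and `V
W*`. Invertibility makes `V = Y A⁻¹` available. -/
lemma ContainsPosSemidef.isUnit_mem (hK : ContainsPosSemidef K) {Y : Matrix ι ι ℂ}
    (hY : IsUnit Y) (hn : ‖Y‖ ≤ 1) : (1, Y) ∈ phaseCone K := by
  set A := CFC.abs Y with hA
  have hA2 : A * A = star Y * Y := CFC.abs_mul_abs Y
  have hAs : IsSelfAdjoint A := (CFC.abs_nonneg Y).isSelfAdjoint
  have hAu : IsUnit A := by
    have h : IsUnit (A * A) := by rw [hA2]; exact hY.star.mul hY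
    exact isUnit_of_mul_isUnit_left h
  obtain ⟨u, hu⟩ := hAu
  set B : Matrix ι ι ℂ := ↑u⁻¹ with hB
  have hAB : A * B = 1 := by rw [← hu]; exact u.mul_inv
  have hBA : B * A = 1 := by rw [← hu]; exact u.inv_mul
  have hBs : star B = B := by
    have h : star B * A = 1 := by rw [← hAs.star_eq, ← star_mul, hAB, star_one]
    calc star B = star B * (A * B) := by rw [hAB, mul_one]
      _ = B := by rw [← mul_assoc, h, one_mul]
  set V := Y * B with hV
  have hVV : star V * V = 1 := by
    rw [hV, star_mul, hBs, mul_assoc, ← mul_assoc (star Y), ← hA2, mul_assoc, hAB, mul_one, hBA]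
  have hVu : V ∈ unitary (Matrix ι ι ℂ) :=
    ⟨hVV, mul_eq_one_comm.1 hVV⟩
  have hVA : V * A = Y := by rw [hV, mul_assoc, hBA, mul_one]
  have hAn : ‖A‖ ≤ 1 := by rw [hA, CFC.norm_abs]; exact hn
  set a : selfAdjoint (Matrix ι ι ℂ) := ⟨A, hAs⟩ with ha
  set W := selfAdjoint.unitarySelfAddISMul a hAn with hW
  have hWr : (W : Matrix ι ι ℂ) + star (W : Matrix ι ι ℂ) = (2 : ℝ) • A := by
    have h := selfAdjoint.star_coe_unitarySelfAddISMul a hAn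
    have h' : (W : Matrix ι ι ℂ) = (a : Matrix ι ι ℂ) + Complex.I • CFC.sqrt (1 - (a : Matrix ι ι ℂ) ^ 2) := rfl
    rw [show star (W : Matrix ι ι ℂ) = _ from h, h']
    module
  have h1 := hK.unitary_mem (mul_mem hVu W.2)
  have h2 := hK.unitary_mem (mul_mem hVu (star W).2)
  have h3 := smul_mem_of_nonneg _ (by norm_num : (0 : ℝ) ≤ 1 / 2) (Submodule.add_mem _ h1 h2)
  convert h3 using 1
  simp only [Prod.mk_add_mk, Prod.smul_mk, Unitary.coe_star, ← mul_add, hWr]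
  rw [mul_smul_comm, hVA]
  refine Prod.ext ?_ ?_ <;> simp only <;> module

/-- After scaling to `c = 1`, `Y` is the average of `Y - δ` and `Y + δ`. Both are invertible for all
but finitely many `δ`, and they remain contractions if `δ ≤ 1 - s`; this is where `s < 1` enters. -/
lemma ContainsPosSemidef.phaseBall (hK : ContainsPosSemidef K) {s : ℝ} (hs : 0 ≤ s) (hs1 : s < 1) :
    PhaseBall K s := by
  intro c Y hc hf
  rcases hc.eq_or_lt with rfl | hc
  · rw [eq_zero_of_frobSq_le (hf.trans (by simp)), zero_smul]
    exact Submodule.zero_mem _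
  obtain ⟨δ, hδ0, hδ1, hp, hm⟩ : ∃ δ : ℝ, 0 < δ ∧ δ < 1 - s ∧
      (δ : ℂ) ∉ spectrum ℂ (c⁻¹ • Y) ∧ (-δ : ℂ) ∉ spectrum ℂ (c⁻¹ • Y) := by
    have hfin := Matrix.finite_spectrum (c⁻¹ • Y)
    have h1 : ((fun x : ℝ => (x : ℂ)) ⁻¹' spectrum ℂ (c⁻¹ • Y)).Finite :=
      hfin.preimage Complex.ofReal_injective.injOn
    have h2 : ((fun x : ℝ => (-x : ℂ)) ⁻¹' spectrum ℂ (c⁻¹ • Y)).Finite :=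
      hfin.preimage (neg_injective.comp Complex.ofReal_injective).injOn
    obtain ⟨δ, hδ, hδ'⟩ := (Set.Ioo_infinite (sub_pos.2 hs1)).exists_notMem_finite (h1.union h2)
    simp only [Set.mem_union, not_or] at hδ'
    exact ⟨δ, hδ.1, hδ.2, hδ'.1, hδ'.2⟩
  have hn : ‖c⁻¹ • Y‖ ≤ s := by
    rw [norm_smul, norm_inv, Real.norm_of_nonneg hc.le, inv_mul_le_iff₀ hc, mul_comm]
    exact (l2_opNorm_le_sqrt_frobSq Y).trans (Real.sqrt_le_iff.2 ⟨by positivity, hf⟩)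
  have hone : ‖(1 : Matrix ι ι ℂ)‖ ≤ 1 := by
    rcases subsingleton_or_nontrivial (Matrix ι ι ℂ) with h | h
    · rw [Subsingleton.elim (1 : Matrix ι ι ℂ) 0, norm_zero]; exact zero_le_one
    · rw [norm_one]
  have hmem : ∀ η : ℝ, |η| ≤ 1 - s → (η : ℂ) ∉ spectrum ℂ (c⁻¹ • Y) →
      (1, c⁻¹ • Y - η • 1) ∈ phaseCone K := by
    intro η hη hη'
    refine hK.isUnit_mem ?_ ?_
    · rw [spectrum.notMem_iff] at hη'
      have := hη'.neg
      rwa [neg_sub, Algebra.algebraMap_eq_smul_one, Complex.coe_smul] at this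
    · refine (norm_sub_le _ _).trans ?_
      have h1 : ‖η • (1 : Matrix ι ι ℂ)‖ ≤ |η| := by
        rw [norm_smul, Real.norm_eq_abs]
        exact mul_le_of_le_one_right (abs_nonneg η) hone
      linarith
  have h1 := hmem δ (by rw [abs_of_pos hδ0]; exact hδ1.le) hp
  have h2 := hmem (-δ) (by rw [abs_neg, abs_of_pos hδ0]; exact hδ1.le) (by simpa using hm)
  have h3 := smul_mem_of_nonneg _ (by positivity : (0 : ℝ) ≤ c / 2) (Submodule.add_mem _ h1 h2)
  convert h3 using 1
  refine Prod.ext ?_ ?_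
  · simp only [Prod.mk_add_mk, Prod.smul_mk]; module
  · simp only [Prod.mk_add_mk, Prod.smul_mk]
    have : Y = c • c⁻¹ • Y := by rw [smul_inv_smul₀ hc.ne']
    conv_lhs => rw [this]
    module

end contraction

/-! ### Separable balls by induction on the tensor factors -/

section induction

/-- The number of tensor factors of dimension at least two. -/
def nontrivialCount {n : ℕ} (d : Fin n → ℕ) : ℕ := (Finset.univ.filter fun i => 2 ≤ d i).card

lemma nontrivialCount_succ_of_one {n : ℕ} {d : Fin (n + 1) → ℕ} (h : d 0 = 1) :
    nontrivialCount d = nontrivialCount (tailDims d) := by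
  unfold nontrivialCount
  rw [Fin.card_filter_univ_succ, if_neg (by omega)]

lemma nontrivialCount_succ_of_two_le {n : ℕ} {d : Fin (n + 1) → ℕ} (h : 2 ≤ d 0) :
    nontrivialCount d = nontrivialCount (tailDims d) + 1 := by
  unfold nontrivialCount
  rw [Fin.card_filter_univ_succ, if_pos h]

lemma nontrivialCount_le {n : ℕ} (d : Fin n → ℕ) : nontrivialCount d ≤ n :=
  (Finset.card_filter_le _ _).trans (by simp)

lemma two_pow_nontrivialCount_le {n : ℕ} {d : Fin n → ℕ} (hd : ∀ i, 1 ≤ d i) :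
    2 ^ nontrivialCount d ≤ ∏ i, d i := by
  unfold nontrivialCount
  rw [← Finset.prod_const, Finset.prod_filter]
  refine Finset.prod_le_prod' fun i _ => ?_
  split_ifs with h
  exacts [h, hd i]

lemma mem_sepCone_of_block_mem {n : ℕ} {d : Fin (n + 1) → ℕ} (h : d 0 = 1) (i : Fin (d 0))
    {Δ : Matrix (Idx d) (Idx d) ℂ} (hΔ : block Δ i i ∈ sepCone (tailDims d)) : Δ ∈ sepCone d := by
  have hs : Subsingleton (Fin (d 0)) := by rw [h]; infer_instance
  have := headTensor_mem (P := single i i 1) (by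
    rw [← diagonal_single]
    exact PosSemidef.diagonal (Pi.single_nonneg.2 zero_le_one)) hΔ
  rwa [← sum_headTensor_block Δ, Fintype.sum_subsingleton _ i, Fintype.sum_subsingleton _ i]

/-- Factors of dimension one are scalars, so with at most one other factor there is nothing to be
entangled. -/
lemma containsPosSemidef_sepCone {n : ℕ} {d : Fin n → ℕ} (hd : ∀ i, 1 ≤ d i)
    (hm : nontrivialCount d ≤ 1) : ContainsPosSemidef (sepCone d) := by
  induction n with
  | zero =>
    intro M hM
    have h0 : 0 ≤ M default default := hM.diag_nonneg
    have ht : tensor (d := d) (fun i => i.elim0) ∈ sepCone d :=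
      Submodule.subset_span ⟨_, fun i => i.elim0, rfl⟩
    convert smul_mem_of_nonneg _ (Complex.le_def.1 h0).1 ht using 1
    ext x y
    rw [Subsingleton.elim x default, Subsingleton.elim y default]
    simp only [tensor, Matrix.smul_apply, Matrix.of_apply, Finset.univ_eq_empty,
      Finset.prod_empty, Complex.real_smul, mul_one]
    exact Complex.ext (by simp) (by simpa using (Complex.le_def.1 h0).2.symm)
  | succ n ih =>
    intro M hM
    have hd' : ∀ i, 1 ≤ tailDims d i := fun i => hd i.succ
    rcases (hd 0).eq_or_lt with h | h
    · refine mem_sepCone_of_block_mem h.symm ⟨0, hd 0⟩ ?_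
      refine ih hd' (by rwa [← nontrivialCount_succ_of_one h.symm]) _ ?_
      exact hM.submatrix _
    · rw [nontrivialCount_succ_of_two_le h] at hm
      have h0 : nontrivialCount (tailDims d) = 0 := by omega
      have h1 : ∀ i, d (Fin.succ i) = 1 := fun i => by
        rw [nontrivialCount, Finset.card_eq_zero, Finset.filter_eq_empty_iff] at h0
        have := h0 (Finset.mem_univ i)
        have := hd i.succ
        simp only [tailDims] at *
        omega
      have hs : ∀ i, Subsingleton (Fin (tailDims d i)) := fun i => by
        simp only [tailDims, h1]; infer_instance
      have hone : (1 : Matrix (Idx (tailDims d)) (Idx (tailDims d)) ℂ) ∈ sepCone (tailDims d) :=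
        ih hd' (by omega) _ PosSemidef.one
      let x₀ : Idx (tailDims d) := fun i => ⟨0, hd' i⟩
      have hP : (M.submatrix (fun i : Fin (d 0) => (Fin.cons i x₀ : Idx d))
          (fun i => (Fin.cons i x₀ : Idx d))).PosSemidef := hM.submatrix _
      convert headTensor_mem hP hone using 1
      ext x y
      have hx : ∀ z : Idx d, (Fin.cons (z 0) x₀ : Idx d) = z := fun z => by
        rw [← Subsingleton.elim (Fin.tail z : Idx (tailDims d)) x₀]
        exact Fin.cons_self_tail z
      simp only [headTensor, Matrix.of_apply, Matrix.submatrix_apply, hx]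
      rw [Subsingleton.elim (Fin.tail x : Idx (tailDims d)) (Fin.tail y), Matrix.one_apply_eq,
        mul_one]

lemma hermBall_of_one_add_mem {ι : Type*} [Fintype ι] [DecidableEq ι]
    {K : Submodule ℝ≥0 (Matrix ι ι ℂ)} {r : ℝ}
    (h : ∀ Y : Matrix ι ι ℂ, Y.IsHermitian → frobSq Y ≤ r ^ 2 → 1 + Y ∈ K) : HermBall K r := by
  intro c Y hc hY hf
  rcases hc.eq_or_lt with rfl | hc
  · rw [eq_zero_of_frobSq_le (hf.trans (by simp))]; simp
  have h1 := h (c⁻¹ • Y) (by ext x y; simp [Matrix.conjTranspose_apply, ← hY.apply x y]) (by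
    rw [frobSq_smul, inv_pow, inv_mul_le_iff₀ (by positivity)]
    linarith)
  convert smul_mem_of_nonneg _ hc.le h1 using 1
  rw [smul_add, smul_inv_smul₀ hc.ne']

lemma frobSq_block_of_subsingleton {n : ℕ} {d : Fin (n + 1) → ℕ} (h : d 0 = 1) (i : Fin (d 0))
    (Δ : Matrix (Idx d) (Idx d) ℂ) : frobSq (block Δ i i) = frobSq Δ := by
  have hs : Subsingleton (Fin (d 0)) := by rw [h]; infer_instance
  rw [frobSq_eq_sum_block, Fintype.sum_subsingleton _ i, Fintype.sum_subsingleton _ i]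

/-- The separable ball around the identity: its radius loses a factor `√2` with each nontrivial
tensor factor after the second. -/
lemma hermBall_sepCone {n : ℕ} {d : Fin n → ℕ} (hd : ∀ i, 1 ≤ d i) {r : ℝ} (hr : 0 ≤ r)
    (hr1 : r < 1) (hm : r ^ 2 * 2 ^ nontrivialCount d < 4) : HermBall (sepCone d) r := by
  induction n generalizing r with
  | zero =>
    have h := (containsPosSemidef_sepCone hd ((nontrivialCount_le d).trans zero_le_one)).hermBall
    exact h.mono hr hr1.le
  | succ n ih =>
    have hd' : ∀ i, 1 ≤ tailDims d i := fun i => hd i.succ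
    refine hermBall_of_one_add_mem fun Y hY hf => ?_
    rcases (hd 0).eq_or_lt with h | h
    · refine mem_sepCone_of_block_mem h.symm ⟨0, hd 0⟩ ?_
      rw [nontrivialCount_succ_of_one h.symm] at hm
      have := ih hd' hr hr1 hm 1 (block Y ⟨0, hd 0⟩ ⟨0, hd 0⟩) zero_le_one
        (block_conjTranspose hY _ _)
        (by rw [frobSq_block_of_subsingleton h.symm, mul_one]; exact hf)
      rwa [block_add, block_one_same, ← one_smul ℝ (1 : Matrix (Idx (tailDims d)) _ ℂ)]
    · rw [nontrivialCount_succ_of_two_le h] at hm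
      set m := nontrivialCount (tailDims d) with hmdef
      obtain ⟨t, s, ht, hs, hH, hP, hst, hrs⟩ : ∃ t s : ℝ, 0 < t ∧ 0 < s ∧
          HermBall (sepCone (tailDims d)) t ∧ PhaseBall (sepCone (tailDims d)) s ∧ s ≤ t ∧
          r < s := by
        by_cases hm1 : m ≤ 1
        · have hc := containsPosSemidef_sepCone hd' hm1
          refine ⟨(1 + r) / 2, (1 + r) / 2, by positivity, by positivity,
            hc.hermBall.mono (by positivity) (by linarith),
            hc.phaseBall (by positivity) (by linarith), le_rfl, by linarith⟩
        · push Not at hm1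
          have h4 : (4 : ℝ) ≤ 2 ^ m := by
            calc (4 : ℝ) = 2 ^ 2 := by norm_num
              _ ≤ 2 ^ m := pow_le_pow_right₀ (by norm_num) hm1
          have hpm : (0 : ℝ) < 2 ^ m := by positivity
          rw [pow_succ (2 : ℝ) m] at hm
          set q : ℝ := (2 * r ^ 2 + 4 / 2 ^ m) / 2 with hq
          have h5 : 2 * r ^ 2 < 4 / 2 ^ m := by rw [lt_div_iff₀ hpm]; linarith
          have h6 : (4 : ℝ) / 2 ^ m ≤ 1 := by rw [div_le_one hpm]; exact h4
          have hq0 : 0 < q := by positivity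
          have hH := ih hd' (r := √q) (Real.sqrt_nonneg _)
            (by rw [Real.sqrt_lt' one_pos]; linarith)
            (by
              rw [Real.sq_sqrt hq0.le, ← hmdef, ← lt_div_iff₀ hpm]
              linarith)
          have h2 : 0 < √2 := by positivity
          refine ⟨√q, √q / √2, Real.sqrt_pos.2 hq0, by positivity, hH,
            hH.phaseBall (Real.sqrt_pos.2 hq0), ?_, ?_⟩
          · exact div_le_self (Real.sqrt_nonneg _) (Real.one_le_sqrt.2 (by norm_num))
          · rw [← Real.sqrt_div' _ (by norm_num)]
            refine Real.lt_sqrt_of_sq_lt ?_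
            linarith
      refine one_add_mem_of_weighted hY ht hs hH hP ?_
      calc ∑ i, ∑ j, frobSq (block Y i j) / (if i = j then t else s) ^ 2
          ≤ ∑ i, ∑ j, frobSq (block Y i j) / s ^ 2 := by
            refine Finset.sum_le_sum fun i _ => Finset.sum_le_sum fun j _ => ?_
            have := frobSq_nonneg (block Y i j)
            have h1 : s ≤ (if i = j then t else s) := by split_ifs <;> simp [hst]
            gcongr
        _ = frobSq Y / s ^ 2 := by
            rw [frobSq_eq_sum_block]; simp only [Finset.sum_div]
        _ < 1 := by
            rw [div_lt_one (by positivity)]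
            exact hf.trans_lt (by gcongr)

lemma frobSq_vecMulVec {ι : Type*} [Fintype ι] (τ : ℝ) (v w : ι → ℂ) :
    frobSq (τ • vecMulVec v (star w)) = τ ^ 2 * ((∑ x, ‖v x‖ ^ 2) * ∑ y, ‖w y‖ ^ 2) := by
  rw [frobSq_smul, frobSq, Finset.sum_mul_sum]
  simp [vecMulVec_apply, mul_pow]

/-- Mixtures of a pure state with the identity for at least three nontrivial factors. -/
lemma one_add_pure_mem {n : ℕ} {d : Fin n → ℕ} (hd : ∀ i, 1 ≤ d i) (hm : 3 ≤ nontrivialCount d)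
    {v : Idx d → ℂ} (hv : ∑ x, ‖v x‖ ^ 2 = 1) {τ : ℝ}
    (hτ : τ ^ 2 * (2 - 2 ^ nontrivialCount d / (2 * ((∏ i, d i : ℕ) : ℝ))) * 2 ^ nontrivialCount d
      < 8) :
    1 + τ • vecMulVec v (star v) ∈ sepCone d := by
  induction n with
  | zero => exact absurd (nontrivialCount_le d) (by omega)
  | succ n ih =>
    have hd' : ∀ i, 1 ≤ tailDims d i := fun i => hd i.succ
    have hprod : ∏ i, d i = d 0 * ∏ i, tailDims d i := Fin.prod_univ_succ d
    rcases (hd 0).eq_or_lt with h | h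
    · refine mem_sepCone_of_block_mem h.symm ⟨0, hd 0⟩ ?_
      rw [block_add, block_one_same]
      have hs : Subsingleton (Fin (d 0)) := by rw [← h]; infer_instance
      refine ih hd' (v := fun x => v (Fin.cons ⟨0, hd 0⟩ x)) ?_ ?_ ?_
      · rwa [← nontrivialCount_succ_of_one h.symm]
      · rwa [sum_idx_succ, Fintype.sum_subsingleton _ ⟨0, hd 0⟩] at hv
      · rw [← h, one_mul] at hprod
        rwa [← nontrivialCount_succ_of_one h.symm, ← hprod]
    · have hle := two_pow_nontrivialCount_le hd'
      rw [nontrivialCount_succ_of_two_le h] at hm hτ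
      set m := nontrivialCount (tailDims d) with hmdef
      set a : Fin (d 0) → ℝ := fun i => ∑ x : Idx (tailDims d), ‖v (Fin.cons i x)‖ ^ 2 with ha
      have hasum : ∑ i, a i = 1 := by rw [← hv, sum_idx_succ]
      have hd0 : (0 : ℝ) < d 0 := by exact_mod_cast (by omega : 0 < d 0)
      have hcs : 1 / (d 0 : ℝ) ≤ ∑ i, a i ^ 2 := by
        have := sq_sum_le_card_mul_sum_sq (s := Finset.univ) (f := a)
        rw [hasum, Finset.card_univ, Fintype.card_fin] at this
        rw [div_le_iff₀ hd0]; linarith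
      have h4 : (4 : ℝ) ≤ 2 ^ m := by
        calc (4 : ℝ) = 2 ^ 2 := by norm_num
          _ ≤ 2 ^ m := pow_le_pow_right₀ (by norm_num) (by omega)
      have hpm : (0 : ℝ) < 2 ^ m := by positivity
      -- The block `(i, j)` has squared norm `τ² a i a j`. Off-diagonal blocks count twice, because
      -- their radius is smaller by `√2`, and diagonal ones once; as `∑ a i = 1`, the total is the
      -- left side. The gain `∑ a i ^ 2 ≥ 1 / d 0` is bounded below in terms of `D`, since the
      -- remaining dimensions multiply to at least `2 ^ m`.
      have hq1 : τ ^ 2 * (2 - ∑ i, a i ^ 2) < 4 / 2 ^ m := by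
        have hT : (0 : ℝ) < ((∏ i, tailDims d i : ℕ) : ℝ) := by
          exact_mod_cast Finset.prod_pos fun i _ => hd' i
        have hle' : (2 : ℝ) ^ m ≤ ((∏ i, tailDims d i : ℕ) : ℝ) := by exact_mod_cast hle
        have h1 : (2 : ℝ) ^ (m + 1) / (2 * ((∏ i, d i : ℕ) : ℝ)) ≤ 1 / d 0 := by
          rw [hprod, Nat.cast_mul, pow_succ, div_le_div_iff₀ (by positivity) hd0]
          nlinarith
        rw [lt_div_iff₀ hpm]
        have h2 : τ ^ 2 * (2 - ∑ i, a i ^ 2) * 2 ^ m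
            ≤ τ ^ 2 * (2 - 2 ^ (m + 1) / (2 * ((∏ i, d i : ℕ) : ℝ))) * 2 ^ m := by
          gcongr; linarith
        rw [pow_succ (2 : ℝ) m, ← mul_assoc] at hτ
        rw [pow_succ (2 : ℝ) m] at h2
        linarith
      have hq0 : 0 ≤ τ ^ 2 * (2 - ∑ i, a i ^ 2) := by
        have h0 : ∀ i, 0 ≤ a i := fun i => Finset.sum_nonneg fun _ _ => by positivity
        have h1 : ∀ i, a i ≤ 1 := fun i =>
          hasum ▸ Finset.single_le_sum (fun j _ => h0 j) (Finset.mem_univ i)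
        have : ∑ i, a i ^ 2 ≤ ∑ i, a i :=
          Finset.sum_le_sum fun i _ => pow_le_of_le_one (h0 i) (h1 i) two_ne_zero
        have : 0 ≤ 2 - ∑ i, a i ^ 2 := by linarith
        positivity
      set q := (τ ^ 2 * (2 - ∑ i, a i ^ 2) + 4 / 2 ^ m) / 2 with hq
      have hqpos : 0 < q := by positivity
      have h6 : (4 : ℝ) / 2 ^ m ≤ 1 := by rw [div_le_one hpm]; exact h4
      have hH := hermBall_sepCone hd' (r := √q) (Real.sqrt_nonneg _)
        (by rw [Real.sqrt_lt' one_pos]; linarith)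
        (by
          rw [Real.sq_sqrt hqpos.le, ← hmdef, ← lt_div_iff₀ hpm]
          linarith)
      have hqs : 0 < √q := Real.sqrt_pos.2 hqpos
      refine one_add_mem_of_weighted ?_ hqs (by positivity : 0 < √q / √2) hH (hH.phaseBall hqs) ?_
      · ext x y
        simp [Matrix.conjTranspose_apply, vecMulVec_apply, mul_comm]
      · have hb : ∀ i j, frobSq (block (τ • vecMulVec v (star v)) i j) = τ ^ 2 * (a i * a j) :=
          fun i j => frobSq_vecMulVec τ (fun x : Idx (tailDims d) => v (Fin.cons i x))
            (fun x : Idx (tailDims d) => v (Fin.cons j x))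
        have hw : ∀ i j : Fin (d 0), τ ^ 2 * (a i * a j) / (if i = j then √q else √q / √2) ^ 2
            = τ ^ 2 / q * (2 * (a i * a j) - if i = j then a i * a j else 0) := fun i j => by
          split_ifs with hij
          · rw [Real.sq_sqrt hqpos.le]; ring
          · rw [div_pow, Real.sq_sqrt hqpos.le, Real.sq_sqrt (by norm_num)]
            field_simp
            ring
        simp only [hb, hw, ← Finset.mul_sum, Finset.sum_sub_distrib, Finset.sum_ite_eq,
          Finset.mem_univ, if_true]
        rw [← Finset.sum_mul, hasum, div_mul_eq_mul_div, div_lt_one hqpos]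
        simp only [← sq]
        linarith

end induction

/-! ### From the cone to states: mixing with the maximally mixed state -/

section normalization

variable {n : ℕ} {d : Fin n → ℕ}

/-- Tensor products of local states. -/
def productStates (d : Fin n → ℕ) : Set (Matrix (Idx d) (Idx d) ℂ) :=
  {M | ∃ σ : ∀ i, Matrix (Fin (d i)) (Fin (d i)) ℂ, (∀ i, σ i ∈ states (Fin (d i))) ∧ tensor σ = M}

lemma trace_tensor (σ : ∀ i, Matrix (Fin (d i)) (Fin (d i)) ℂ) :
    (tensor σ).trace = ∏ i, (σ i).trace := by
  simp only [Matrix.trace, Matrix.diag, tensor, Matrix.of_apply]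
  rw [Finset.prod_univ_sum, Fintype.piFinset_univ]

lemma convexHull_productStates_subset : convexHull ℝ (productStates d) ⊆ sepStates d := by
  intro M hM
  rw [mem_convexHull_iff_exists_fintype] at hM
  obtain ⟨κ, _, w, z, hw, hw1, hz, rfl⟩ := hM
  choose σ hσ hσz using hz
  let e := (Fintype.equivFin κ).symm
  refine ⟨Fintype.card κ, fun j => w (e j), fun j => σ (e j), fun j => hw _, ?_,
    fun j i => hσ _ i, ?_⟩
  · rw [e.sum_comp w, hw1]
  · rw [e.sum_comp fun j => w j • tensor (σ j)]
    simp only [hσz]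

lemma trace_of_mem_convexHull {M : Matrix (Idx d) (Idx d) ℂ}
    (hM : M ∈ convexHull ℝ (productStates d)) : M.trace = 1 := by
  have hconv : Convex ℝ {M : Matrix (Idx d) (Idx d) ℂ | M.trace = 1} := by
    intro A hA B hB a b _ _ hab
    simp only [Set.mem_ofPred_eq] at *
    rw [Matrix.trace_add, Matrix.trace_smul, Matrix.trace_smul, hA, hB, ← add_smul, hab, one_smul]
  refine convexHull_min ?_ hconv hM
  rintro _ ⟨σ, hσ, rfl⟩
  simp [trace_tensor, (hσ _).2]

/-- A nonzero positive semidefinite factor has positive trace, so a nonzero product of such factors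
can be normalized factor by factor. -/
lemma eq_zero_or_smul_of_mem_sepCone {M : Matrix (Idx d) (Idx d) ℂ} (hM : M ∈ sepCone d) :
    M = 0 ∨ ∃ c : ℝ, 0 < c ∧ ∃ ρ ∈ convexHull ℝ (productStates d), M = c • ρ := by
  induction hM using Submodule.span_induction with
  | mem M hM =>
    obtain ⟨σ, hσ, rfl⟩ := hM
    have htr : ∀ i, ((σ i).trace.re : ℂ) = (σ i).trace := fun i =>
      Complex.ext (by simp) (by simpa using (Complex.le_def.1 (hσ i).trace_nonneg).2)
    have hre : ∀ i, 0 ≤ (σ i).trace.re := fun i => (Complex.le_def.1 (hσ i).trace_nonneg).1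
    by_cases h0 : ∃ i, σ i = 0
    · left
      obtain ⟨i, hi⟩ := h0
      ext x y
      simp only [tensor, Matrix.of_apply, Matrix.zero_apply]
      exact Finset.prod_eq_zero (Finset.mem_univ i) (by simp [hi])
    · push Not at h0
      right
      have hpos : ∀ i, 0 < (σ i).trace.re := fun i => by
        refine (hre i).lt_of_ne' fun h => h0 i ?_
        rw [← (hσ i).trace_eq_zero_iff, ← htr, h, Complex.ofReal_zero]
      refine ⟨∏ i, (σ i).trace.re, Finset.prod_pos fun i _ => hpos i,
        tensor fun i => (σ i).trace.re⁻¹ • σ i, subset_convexHull _ _ ⟨_, fun i => ⟨?_, ?_⟩, rfl⟩,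
        ?_⟩
      · exact (hσ i).smul (inv_nonneg.2 (hre i))
      · rw [Matrix.trace_smul, ← htr i]
        simp [(hpos i).ne']
      · ext x y
        simp only [tensor, Matrix.of_apply, Matrix.smul_apply, Complex.real_smul,
          Finset.prod_mul_distrib, Complex.ofReal_prod, Complex.ofReal_inv, Finset.prod_inv_distrib]
        rw [mul_inv_cancel_left₀]
        exact Finset.prod_ne_zero_iff.2 fun i _ => by exact_mod_cast (hpos i).ne'
  | zero => exact Or.inl rfl
  | add M N _ _ hM hN =>
    rcases hM with rfl | ⟨c, hc, ρ, hρ, rfl⟩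
    · simpa using hN
    rcases hN with rfl | ⟨c', hc', ρ', hρ', rfl⟩
    · exact Or.inr ⟨c, hc, ρ, hρ, by simp⟩
    refine Or.inr ⟨c + c', by positivity, (c / (c + c')) • ρ + (c' / (c + c')) • ρ',
      (convex_convexHull ℝ _) hρ hρ' (by positivity) (by positivity) (by field_simp), ?_⟩
    have : c + c' ≠ 0 := by positivity
    rw [smul_add, smul_smul, smul_smul, mul_div_cancel₀ _ this, mul_div_cancel₀ _ this]
  | smul c M _ hM =>
    rcases hM with rfl | ⟨c', hc', ρ, hρ, rfl⟩
    · simp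
    rcases (zero_le : 0 ≤ c).eq_or_lt with rfl | hc
    · simp
    · exact Or.inr ⟨c * c', by positivity, ρ, hρ, by rw [NNReal.smul_def, smul_smul]⟩

lemma mem_sepStates_of_mem_sepCone {M : Matrix (Idx d) (Idx d) ℂ} (hM : M ∈ sepCone d)
    (htr : M.trace = 1) : M ∈ sepStates d := by
  rcases eq_zero_or_smul_of_mem_sepCone hM with rfl | ⟨c, hc, ρ, hρ, rfl⟩
  · simp at htr
  · rw [Matrix.trace_smul, trace_of_mem_convexHull hρ, Complex.real_smul, mul_one] at htr
    rw [show c = 1 by exact_mod_cast htr, one_smul]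
    exact convexHull_productStates_subset hρ

lemma trace_pure {ι : Type*} [Fintype ι] (v : ι → ℂ) :
    (vecMulVec v (star v)).trace = ((∑ x, ‖v x‖ ^ 2 : ℝ) : ℂ) := by
  simp [Matrix.trace, vecMulVec_apply, Complex.mul_conj, Complex.normSq_eq_norm_sq]

lemma exists_pure_decomposition {ι : Type*} [Fintype ι] {ρ : Matrix ι ι ℂ} (hρ : ρ ∈ states ι) :
    ∃ (m : ℕ) (v : Fin m → ι → ℂ), ρ = ∑ k, vecMulVec (v k) (star (v k)) ∧
      ∑ k, ∑ x, ‖v k x‖ ^ 2 = 1 := by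
  obtain ⟨m, v, hv⟩ := Matrix.posSemidef_iff_eq_sum_vecMulVec.1 hρ.1
  refine ⟨m, v, hv, ?_⟩
  have h1 := hρ.2
  rw [hv, Matrix.trace_sum] at h1
  simp only [trace_pure] at h1
  exact_mod_cast h1

/-- Membership of mixtures with the identity extends from pure states to all states. -/
lemma smul_one_add_smul_mem_of_pure {ι : Type*} [Fintype ι] [DecidableEq ι]
    {K : Submodule ℝ≥0 (Matrix ι ι ℂ)} {a b : ℝ}
    (h : ∀ v : ι → ℂ, ∑ x, ‖v x‖ ^ 2 = 1 → a • 1 + b • vecMulVec v (star v) ∈ K)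
    {ρ : Matrix ι ι ℂ} (hρ : ρ ∈ states ι) : a • 1 + b • ρ ∈ K := by
  obtain ⟨m, v, hv, htr⟩ := exists_pure_decomposition hρ
  have hmem : ∀ k, (∑ x, ‖v k x‖ ^ 2) • a • (1 : Matrix ι ι ℂ) + b • vecMulVec (v k) (star (v k))
      ∈ K := by
    intro k
    set N := ∑ x, ‖v k x‖ ^ 2 with hN
    have hN0 : 0 ≤ N := Finset.sum_nonneg fun _ _ => by positivity
    rcases hN0.eq_or_lt with h0 | h0
    · have hz : v k = 0 := by
        ext x
        have := (Finset.sum_eq_zero_iff_of_nonneg (fun _ _ => by positivity)).1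
          (hN.symm.trans h0.symm) x (Finset.mem_univ x)
        simpa using this
      rw [← h0, hz]; simp
    · have h1 := h ((√N)⁻¹ • v k) (by
        simp only [Pi.smul_apply, norm_smul, mul_pow, ← Finset.mul_sum, ← hN, norm_inv, inv_pow,
          Real.norm_eq_abs, sq_abs, Real.sq_sqrt hN0]
        exact inv_mul_cancel₀ h0.ne')
      convert smul_mem_of_nonneg _ hN0 h1 using 1
      rw [smul_add]
      congr 1
      ext x y
      simp only [Matrix.smul_apply, vecMulVec_apply, Pi.smul_apply, Pi.star_apply,
        Complex.real_smul, star_mul', Complex.star_def, Complex.ofReal_inv]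
      have h2 : ((√N : ℝ) : ℂ) * ((√N : ℝ) : ℂ) = N := by exact_mod_cast Real.mul_self_sqrt hN0
      have h3 : ((√N : ℝ) : ℂ) ≠ 0 := by exact_mod_cast (Real.sqrt_pos.2 h0).ne'
      rw [← h2, map_inv₀, Complex.conj_ofReal]
      field_simp
  have hsum := Submodule.sum_mem K fun k (_ : k ∈ Finset.univ) => hmem k
  rw [Finset.sum_add_distrib, ← Finset.sum_smul, htr, one_smul, ← Finset.smul_sum, ← hv] at hsum
  exact hsum

/-- Mixing any state with the maximally mixed one in the proportion `ε : 1 - ε` gives a separable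
state. -/
def MixesSeparably (d : Fin n → ℕ) (ε : ℝ) : Prop :=
  ∀ ρ ∈ states (Idx d), ((1 - ε) / ((∏ i, d i : ℕ) : ℝ)) • (1 : Matrix (Idx d) (Idx d) ℂ) + ε • ρ
    ∈ sepStates d

lemma trace_mix {ρ : Matrix (Idx d) (Idx d) ℂ} (hρ : ρ.trace = 1) (hD : 0 < ∏ i, d i) (ε : ℝ) :
    (((1 - ε) / ((∏ i, d i : ℕ) : ℝ)) • (1 : Matrix (Idx d) (Idx d) ℂ) + ε • ρ).trace = 1 := by
  have hD' : (((∏ i, d i : ℕ) : ℝ) : ℂ) ≠ 0 := by exact_mod_cast hD.ne'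
  rw [Matrix.trace_add, Matrix.trace_smul, Matrix.trace_smul, hρ, Matrix.trace_one,
    Fintype.card_pi]
  simp only [Fintype.card_fin, Complex.real_smul, mul_one]
  push_cast at hD' ⊢
  rw [div_mul_cancel₀ _ hD']
  ring

lemma mixesSeparably_of_pure (hD : 0 < ∏ i, d i) {ε : ℝ}
    (h : ∀ v : Idx d → ℂ, ∑ x, ‖v x‖ ^ 2 = 1 →
      ((1 - ε) / ((∏ i, d i : ℕ) : ℝ)) • (1 : Matrix (Idx d) (Idx d) ℂ)
        + ε • vecMulVec v (star v) ∈ sepCone d) : MixesSeparably d ε := fun _ hρ =>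
  mem_sepStates_of_mem_sepCone (smul_one_add_smul_mem_of_pure h hρ) (trace_mix hρ.2 hD ε)

lemma mixesSeparably_of_count_le_one (hd : ∀ i, 1 ≤ d i) (hm : nontrivialCount d ≤ 1) {ε : ℝ}
    (h0 : 0 ≤ ε) (h1 : ε ≤ 1) : MixesSeparably d ε := by
  refine mixesSeparably_of_pure (Finset.prod_pos fun i _ => hd i) fun v _ =>
    containsPosSemidef_sepCone hd hm _ ?_
  exact (PosSemidef.one.smul (div_nonneg (sub_nonneg.2 h1) (Nat.cast_nonneg _))).add
    ((posSemidef_vecMulVec_self_star v).smul h0)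

lemma frobSq_smul_one_add_pure {ι : Type*} [Fintype ι] [DecidableEq ι] (a b : ℝ) {v : ι → ℂ}
    (hv : ∑ x, ‖v x‖ ^ 2 = 1) : frobSq (a • (1 : Matrix ι ι ℂ) + b • vecMulVec v (star v))
      = a ^ 2 * Fintype.card ι + 2 * a * b + b ^ 2 := by
  have h : ∀ x y, ‖(a • (1 : Matrix ι ι ℂ) + b • vecMulVec v (star v)) x y‖ ^ 2
      = (if x = y then a ^ 2 + 2 * a * b * ‖v x‖ ^ 2 else 0) + b ^ 2 * (‖v x‖ ^ 2 * ‖v y‖ ^ 2) := by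
    intro x y
    simp only [Matrix.add_apply, Matrix.smul_apply, vecMulVec_apply, Pi.star_apply,
      Matrix.one_apply, Complex.real_smul]
    split_ifs with hxy
    · subst hxy
      rw [Complex.star_def, Complex.mul_conj, Complex.normSq_eq_norm_sq, mul_one,
        ← Complex.ofReal_mul, ← Complex.ofReal_add, Complex.norm_real, Real.norm_eq_abs, sq_abs]
      ring
    · simp [mul_pow]
  unfold frobSq
  simp only [h, Finset.sum_add_distrib, Finset.sum_ite_eq, Finset.mem_univ, if_true,
    ← Finset.mul_sum, hv, mul_one]
  simp
  ring

/-- For two nontrivial factors every weight below `1 / (D - 1)` is admissible. -/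
lemma mixesSeparably_of_count_eq_two (hd : ∀ i, 1 ≤ d i) (hm : nontrivialCount d = 2) {ε : ℝ}
    (h0 : 0 ≤ ε) (h1 : ε < 1 / (((∏ i, d i : ℕ) : ℝ) - 1)) : MixesSeparably d ε := by
  refine mixesSeparably_of_pure (Finset.prod_pos fun i _ => hd i) fun v hv => ?_
  have hD4 : (4 : ℝ) ≤ ((∏ i, d i : ℕ) : ℝ) := by
    have := two_pow_nontrivialCount_le hd
    rw [hm] at this
    exact_mod_cast this
  have hcard : ((Fintype.card (Idx d) : ℕ) : ℝ) = ((∏ i, d i : ℕ) : ℝ) := by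
    rw [Fintype.card_pi]; simp
  set D : ℝ := ((∏ i, d i : ℕ) : ℝ) with hD
  -- For a trace-one operator `M`, the quantity `‖M - c 1‖² - c² = (D - 1) c² - 2 c + ‖M‖²` is
  -- smallest at `c = 1 / (D - 1)`. This is therefore the best amount of identity to split off.
  set u := 1 / (D - 1) with hu
  have hD1 : 0 < D - 1 := by linarith
  have hu0 : 0 < u := by positivity
  have huD : u * (D - 1) = 1 := by rw [hu]; field_simp
  have hsplit : ((1 - ε) / D) • (1 : Matrix (Idx d) (Idx d) ℂ) + ε • vecMulVec v (star v)
      = u • 1 + (((1 - ε) / D - u) • (1 : Matrix (Idx d) (Idx d) ℂ)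
        + ε • vecMulVec v (star v)) := by module
  rw [hsplit]
  set f := u ^ 2 / D + ε ^ 2 * (1 - 1 / D) with hf
  have hfeq : frobSq (((1 - ε) / D - u) • (1 : Matrix (Idx d) (Idx d) ℂ)
        + ε • vecMulVec v (star v)) = f := by
    rw [frobSq_smul_one_add_pure _ _ hv, hcard, hf]
    have hD0 : D ≠ 0 := by positivity
    have : (1 - ε) / D - u = -(u + ε) / D := by
      field_simp
      linear_combination -huD
    rw [this]
    field_simp
    ring
  have hflt : f < u ^ 2 := by
    have h2 : ε ^ 2 < u ^ 2 := by gcongr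
    have h3 : 0 < 1 - 1 / D := by
      rw [sub_pos, div_lt_one (by positivity)]; linarith
    have h4 : u ^ 2 = u ^ 2 / D + u ^ 2 * (1 - 1 / D) := by ring
    rw [h4, hf]
    gcongr
  have hf0 : 0 ≤ f := hfeq ▸ frobSq_nonneg _
  have hr2 : √(f / u ^ 2) ^ 2 = f / u ^ 2 := Real.sq_sqrt (by positivity)
  have hlt1 : f / u ^ 2 < 1 := by rw [div_lt_one (by positivity)]; exact hflt
  -- With two nontrivial factors the two conditions on the radius coincide: both say `r² < 1`.
  refine hermBall_sepCone hd (r := √(f / u ^ 2)) (Real.sqrt_nonneg _)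
    (by rw [Real.sqrt_lt' one_pos]; linarith) (by rw [hr2, hm]; linarith) u _ hu0.le ?_ ?_
  · ext x y
    simp [Matrix.conjTranspose_apply, vecMulVec_apply, mul_comm, Matrix.one_apply, eq_comm]
    split_ifs <;> simp
  · rw [hfeq, mul_pow, hr2, div_mul_cancel₀ _ (by positivity)]

/-- For three or more nontrivial factors. -/
lemma mixesSeparably_of_three_le_count (hd : ∀ i, 1 ≤ d i) (hm : 3 ≤ nontrivialCount d) {ε : ℝ}
    (h1 : ε < 1)
    (h : (ε * ((∏ i, d i : ℕ) : ℝ) / (1 - ε)) ^ 2 *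
      (2 - 2 ^ nontrivialCount d / (2 * ((∏ i, d i : ℕ) : ℝ))) * 2 ^ nontrivialCount d < 8) :
    MixesSeparably d ε := by
  have hD : 0 < ∏ i, d i := Finset.prod_pos fun i _ => hd i
  refine mixesSeparably_of_pure hD fun v hv => ?_
  have hD' : (0 : ℝ) < ((∏ i, d i : ℕ) : ℝ) := by exact_mod_cast hD
  have hε : 0 < 1 - ε := sub_pos.2 h1
  have hmem := smul_mem_of_nonneg _ (by positivity : 0 ≤ (1 - ε) / ((∏ i, d i : ℕ) : ℝ))
    (one_add_pure_mem hd hm hv h)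
  convert hmem using 1
  rw [smul_add, smul_smul]
  congr 2
  field_simp

end normalization

/-! ### Estimates for the constants -/

section constants

/-- The square of `bConst`. -/
def bSq (n : ℕ) (D : ℝ) : ℝ := D ^ n / ((2 * D - 1) ^ ((n : ℤ) - 2) * (D ^ 2 - 1) + 1)

variable {D : ℝ}

lemma bSq_den_pos (hD : 2 ≤ D) (n : ℕ) :
    0 < (2 * D - 1) ^ ((n : ℤ) - 2) * (D ^ 2 - 1) + 1 := by
  have h1 : 0 < 2 * D - 1 := by linarith
  have h2 : 0 < D ^ 2 - 1 := by nlinarith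
  positivity

lemma bSq_nonneg (hD : 2 ≤ D) (n : ℕ) : 0 ≤ bSq n D :=
  div_nonneg (by positivity) (bSq_den_pos hD n).le

lemma bConst_sq (hD : 2 ≤ D) (n : ℕ) : bConst n D ^ 2 = bSq n D := Real.sq_sqrt (bSq_nonneg hD n)

/-- With `A = (2 D - 1) ^ (n - 2)` the claim reduces to `1 ≤ A (D² - 1)`. The worst case `n = 1` is
`2 D - 1 ≤ D² - 1`, true for `D ≥ 2`. Monotonicity in `n` lets the number of nontrivial factors
replace `n`. -/
lemma bSq_succ_le (hD : 2 ≤ D) {n : ℕ} (hn : 1 ≤ n) : bSq (n + 1) D ≤ bSq n D := by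
  have h1 : 1 < 2 * D - 1 := by linarith
  have h0 : 0 < 2 * D - 1 := by linarith
  have h2 : 0 < D ^ 2 - 1 := by nlinarith
  rw [bSq, bSq, div_le_div_iff₀ (bSq_den_pos hD _) (bSq_den_pos hD _)]
  have hz : (2 * D - 1) ^ (((n + 1 : ℕ) : ℤ) - 2) = (2 * D - 1) ^ ((n : ℤ) - 2) * (2 * D - 1) := by
    rw [← zpow_add_one₀ h0.ne']; congr 1; push_cast; ring
  rw [hz]
  set A := (2 * D - 1) ^ ((n : ℤ) - 2) with hA
  have hA1 : (2 * D - 1)⁻¹ ≤ A := by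
    rw [hA, ← _root_.zpow_neg_one]
    exact zpow_le_zpow_right₀ h1.le (by omega)
  have hA2 : 1 ≤ A * (D ^ 2 - 1) := by
    calc 1 = (2 * D - 1)⁻¹ * (2 * D - 1) := (inv_mul_cancel₀ h0.ne').symm
      _ ≤ A * (D ^ 2 - 1) := by
        have : 2 * D - 1 ≤ D ^ 2 - 1 := by nlinarith
        have : 0 ≤ A := (inv_nonneg.2 h0.le).trans hA1
        gcongr
  rw [pow_succ, mul_assoc]
  refine mul_le_mul_of_nonneg_left ?_ (by positivity)
  nlinarith

lemma bSq_anti (hD : 2 ≤ D) {m n : ℕ} (hm : 1 ≤ m) (hmn : m ≤ n) : bSq n D ≤ bSq m D := by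
  induction n, hmn using Nat.le_induction with
  | base => exact le_rfl
  | succ k hk ih => exact (bSq_succ_le hD (hm.trans hk)).trans ih

lemma bSq_two (hD : 2 ≤ D) : bSq 2 D = 1 := by
  have : D ^ 2 ≠ 0 := by positivity
  simp [bSq, this]

/-- For `b² < D` this inequality is `epsConst ≤ 1` with denominators cleared. -/
lemma bSq_one_le (hD : 2 ≤ D) : bSq 1 D * (D ^ 2 + D - 1) ≤ D ^ 3 := by
  have h0 : 0 < 2 * D - 1 := by linarith
  have h2 : 0 < D ^ 2 + 2 * D - 2 := by nlinarith
  have h1 : bSq 1 D = D * (2 * D - 1) / (D ^ 2 + 2 * D - 2) := by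
    have : ((1 : ℕ) : ℤ) - 2 = -1 := by norm_num
    have h3 : (2 * D - 1)⁻¹ * (D ^ 2 - 1) + 1 = (D ^ 2 + 2 * D - 2) / (2 * D - 1) := by
      field_simp; ring
    rw [bSq, this, _root_.zpow_neg_one, pow_one, h3, div_div_eq_mul_div]
  rw [h1, div_mul_eq_mul_div, div_le_iff₀ h2]
  have h3 : (2 * D - 1) * (D ^ 2 + D - 1) ≤ D ^ 2 * (D ^ 2 + 2 * D - 2) := by
    have h4 : 0 ≤ D ^ 2 - 4 := by nlinarith
    nlinarith [mul_nonneg (sq_nonneg D) h4]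
  calc D * (2 * D - 1) * (D ^ 2 + D - 1) = D * ((2 * D - 1) * (D ^ 2 + D - 1)) := by ring
    _ ≤ D * (D ^ 2 * (D ^ 2 + 2 * D - 2)) := by gcongr
    _ = _ := by ring

lemma epsConst_nonneg (hD : 2 ≤ D) (n : ℕ) : 0 ≤ epsConst n D := by
  have : 0 ≤ bConst n D := Real.sqrt_nonneg _
  unfold epsConst
  positivity

lemma epsConst_mul_sq (hD : 2 ≤ D) {n : ℕ} (hb : bSq n D ≤ D) :
    (epsConst n D * D) ^ 2 = bSq n D * (D - 1) / (D - bSq n D) := by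
  have h1 : epsConst n D * D = bConst n D * √((D - 1) / (D - bConst n D ^ 2)) := by
    unfold epsConst; field_simp
  rw [h1, mul_pow, bConst_sq hD, Real.sq_sqrt (div_nonneg (by linarith) (by linarith))]
  ring

lemma bSq_mul_le (hD : 2 ≤ D) {n : ℕ} (hn : 1 ≤ n) : bSq n D * (D ^ 2 + D - 1) ≤ D ^ 3 :=
  (mul_le_mul_of_nonneg_right (bSq_anti hD le_rfl hn) (by nlinarith)).trans (bSq_one_le hD)

lemma bSq_lt (hD : 2 ≤ D) {n : ℕ} (hn : 1 ≤ n) : bSq n D < D := by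
  by_contra h
  push Not at h
  have : D * (D ^ 2 + D - 1) ≤ D ^ 3 := le_trans (by gcongr; nlinarith) (bSq_mul_le hD hn)
  nlinarith

lemma epsConst_pos (hD : 2 ≤ D) {n : ℕ} (hn : 1 ≤ n) : 0 < epsConst n D := by
  have h1 := bSq_lt hD hn
  have h2 : 0 < bSq n D := div_pos (by positivity) (bSq_den_pos hD n)
  have h3 : 0 < (epsConst n D * D) ^ 2 := by
    rw [epsConst_mul_sq hD h1.le]
    exact div_pos (mul_pos h2 (by linarith)) (by linarith)
  refine (epsConst_nonneg hD n).lt_of_ne fun h => ?_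
  rw [← h] at h3
  simp at h3

lemma epsConst_le_one (hD : 2 ≤ D) {n : ℕ} (hn : 1 ≤ n) : epsConst n D ≤ 1 := by
  have h3 := bSq_mul_le hD hn
  have h4 := bSq_lt hD hn
  have h5 := epsConst_mul_sq hD h4.le
  have h6 : (epsConst n D * D) ^ 2 ≤ D ^ 2 := by
    rw [h5, div_le_iff₀ (by linarith)]; nlinarith
  have h7 := abs_le_of_sq_le_sq' h6 (by positivity) |>.2
  exact le_of_mul_le_mul_right (by linarith) (by linarith : 0 < D)

lemma epsConst_mul_sq_le (hD : 2 ≤ D) {n : ℕ} (hn : 2 ≤ n) : (epsConst n D * D) ^ 2 ≤ bSq n D := by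
  have h1 : bSq n D ≤ 1 := bSq_two hD ▸ bSq_anti hD one_le_two hn
  have h0 := bSq_nonneg hD n
  rw [epsConst_mul_sq hD (by linarith), div_le_iff₀ (by linarith)]
  nlinarith

lemma epsConst_mul_le_one (hD : 2 ≤ D) {n : ℕ} (hn : 2 ≤ n) : epsConst n D * D ≤ 1 := by
  have h1 : bSq n D ≤ 1 := bSq_two hD ▸ bSq_anti hD one_le_two hn
  have h2 := epsConst_mul_sq_le hD hn
  exact abs_le_of_sq_le_sq' (by linarith : (epsConst n D * D) ^ 2 ≤ 1 ^ 2) zero_le_one |>.2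

lemma epsConst_lt (hD : 2 ≤ D) {n : ℕ} (hn : 2 ≤ n) : epsConst n D < 1 / (D - 1) := by
  have h := epsConst_mul_le_one hD hn
  have h0 := epsConst_nonneg hD n
  rw [lt_div_iff₀ (by linarith)]
  rcases h0.eq_or_lt with h0 | h0
  · rw [← h0]; norm_num
  · linarith

/-- Bernoulli's inequality for `(1 - 1 / (2 D)) ^ m`, after dropping the `+ 1` in the denominator of
`b²`. -/
lemma bSq_mul_two_pow_le (hD : 2 ≤ D) (m : ℕ) :
    bSq (m + 2) D * 2 ^ m * ((1 - m / (2 * D)) * (1 - 1 / D ^ 2)) ≤ 1 := by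
  have hD0 : 0 < D := by linarith
  have hb : 1 - m / (2 * D) ≤ (1 - 1 / (2 * D)) ^ m := by
    have h1 : 1 / (2 * D) ≤ 1 := by rw [div_le_one (by positivity)]; linarith
    have := one_add_mul_le_pow (a := -(1 / (2 * D))) (by linarith) m
    calc 1 - m / (2 * D) = 1 + m * -(1 / (2 * D)) := by ring
      _ ≤ _ := this
      _ = _ := by ring
  have hz : (2 * D - 1) ^ (((m + 2 : ℕ) : ℤ) - 2) = (2 * D - 1) ^ m := by
    rw [← zpow_natCast]; congr 1; push_cast; ring
  have hden := bSq_den_pos hD (m + 2)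
  rw [hz] at hden
  have h2 : 0 < D ^ 2 - 1 := by nlinarith
  rw [bSq, hz, div_mul_eq_mul_div, div_mul_eq_mul_div, div_le_one hden]
  have h3 : (2 * D - 1) ^ m = (2 * D) ^ m * (1 - 1 / (2 * D)) ^ m := by
    rw [← mul_pow]; congr 1; field_simp
  calc D ^ (m + 2) * 2 ^ m * ((1 - m / (2 * D)) * (1 - 1 / D ^ 2))
      = (2 * D) ^ m * (1 - m / (2 * D)) * (D ^ 2 - 1) := by
        rw [mul_pow, pow_add]; field_simp
    _ ≤ (2 * D) ^ m * (1 - 1 / (2 * D)) ^ m * (D ^ 2 - 1) := by gcongr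
    _ ≤ (2 * D - 1) ^ m * (D ^ 2 - 1) + 1 := by rw [h3]; linarith

/-- The bound for the weight of a pure state follows from a linearized one. -/
lemma weight_lt_of_linear {ε w : ℝ} (hε : ε < 1)
    (h : (ε * D) ^ 2 * w < 8 * (1 - 2 * ε)) : (ε * D / (1 - ε)) ^ 2 * w < 8 := by
  have h1 : 0 < 1 - ε := sub_pos.2 hε
  rw [div_pow, div_mul_eq_mul_div, div_lt_iff₀ (by positivity)]
  nlinarith [sq_nonneg ε]

/-- Here the crude bounds `(ε D)² ≤ b²` and `ε ≤ 1 / D` suffice: the gain `2 ^ m / (2 D)` from the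
diagonal blocks outweighs all other corrections of order `1 / D`. -/
lemma epsConst_weight_lt_of_four_le {m n : ℕ} (hm : 4 ≤ m) (hmn : m ≤ n) (hD : (2 : ℝ) ^ m ≤ D) :
    (epsConst n D * D / (1 - epsConst n D)) ^ 2 * (2 - 2 ^ m / (2 * D)) * 2 ^ m < 8 := by
  obtain ⟨k, rfl⟩ : ∃ k, m = k + 2 := ⟨m - 2, by omega⟩
  -- In units of `t = 1 / D` the losses are `k / 2` from Bernoulli, `2` from `1 - 2 ε`, and less
  -- than `1` from `t²`; the gain is `2 ^ k`. The inequality fails for `k = 1`, so three factors are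
  -- treated separately.
  have hk4 : (k : ℝ) / 2 + 3 ≤ 2 ^ k := by
    have hk : 2 ≤ k := by omega
    clear hmn hD hm
    induction k, hk using Nat.le_induction with
    | base => norm_num
    | succ k hk ih =>
      push_cast
      rw [pow_succ]
      have : (2 : ℝ) ≤ k := by exact_mod_cast hk
      linarith
  have h4k : (4 : ℝ) ≤ 2 ^ k := by
    have : (0 : ℝ) ≤ k := Nat.cast_nonneg k
    have h2 : (2 : ℝ) ≤ k := by exact_mod_cast (by omega : 2 ≤ k)
    linarith
  have hp : (2 : ℝ) ^ (k + 2) = 4 * 2 ^ k := by rw [pow_add]; ring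
  rw [hp] at hD ⊢
  set P : ℝ := 2 ^ k with hP
  have hD2 : 2 ≤ D := by linarith
  have hD0 : 0 < D := by linarith
  have hn2 : 2 ≤ n := by omega
  have hle1 := epsConst_mul_le_one hD2 hn2
  have hεD : epsConst n D ≤ 1 / D := by rw [le_div_iff₀ hD0]; exact hle1
  have hDinv : 1 / D ≤ 1 / 16 := one_div_le_one_div_of_le (by norm_num) (by linarith)
  have hw : 0 ≤ 2 - 4 * P / (2 * D) := by
    rw [sub_nonneg, div_le_iff₀ (by positivity)]; linarith
  rw [mul_assoc]
  refine weight_lt_of_linear (by linarith) ?_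
  have hbound := bSq_mul_two_pow_le hD2 k
  have hsq := (epsConst_mul_sq_le hD2 hn2).trans (bSq_anti hD2 (by omega) hmn)
  set β := bSq (k + 2) D with hβ
  have hβ0 : 0 ≤ β := bSq_nonneg hD2 _
  set t := 1 / D with ht
  have ht0 : 0 < t := by positivity
  have hPt : P * t ≤ 1 / 4 := by
    rw [ht, mul_one_div, div_le_iff₀ hD0]; linarith
  have e1 : (k : ℝ) / (2 * D) = k * t / 2 := by rw [ht]; field_simp
  have e2 : 1 / D ^ 2 = t ^ 2 := by rw [ht]; field_simp
  have e3 : 4 * P / (2 * D) = 2 * (P * t) := by rw [ht]; field_simp; norm_num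
  rw [e1, e2] at hbound
  rw [e3] at hw ⊢
  have hk0 : (0 : ℝ) ≤ k := Nat.cast_nonneg k
  have hkt : k * t ≤ 1 / 2 := by nlinarith
  set L := (1 - k * t / 2) * (1 - t ^ 2) with hL
  have hLpos : 0 < L := by
    rw [hL]; exact mul_pos (by linarith) (by nlinarith)
  have key : 1 - P * t < (1 - 2 * t) * L := by
    have hu : 0 ≤ k * t / 2 := by positivity
    have hu1 : k * t / 2 ≤ 1 := by linarith
    have htt : t ^ 2 < t := by nlinarith
    have huw : 0 ≤ k * t / 2 * t ^ 2 := by positivity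
    have huw' : k * t / 2 * t ^ 2 ≤ 1 * t ^ 2 := by gcongr
    have hLe : L = 1 - k * t / 2 - t ^ 2 + k * t / 2 * t ^ 2 := by rw [hL]; ring
    have htL : t * L ≤ t * 1 := by
      refine mul_le_mul_of_nonneg_left ?_ ht0.le
      linarith
    have h4 : (k / 2 + 3) * t ≤ P * t := mul_le_mul_of_nonneg_right hk4 ht0.le
    linarith
  have hβP : β * P ≤ 1 / L := by rw [le_div_iff₀ hLpos]; exact hbound
  calc (epsConst n D * D) ^ 2 * ((2 - 2 * (P * t)) * (4 * P))
      ≤ β * ((2 - 2 * (P * t)) * (4 * P)) := by gcongr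
    _ = 8 * ((1 - P * t) * (β * P)) := by ring
    _ ≤ 8 * ((1 - P * t) * (1 / L)) := by
        have : 0 ≤ 1 - P * t := by linarith
        gcongr
    _ < 8 * (1 - 2 * t) := by
        have : (1 - P * t) * (1 / L) < 1 - 2 * t := by
          rw [mul_one_div, div_lt_iff₀ hLpos]; exact key
        linarith
    _ ≤ 8 * (1 - 2 * epsConst n D) := by linarith

/-- The factor `(D - 1) / (D - b²)`, discarded for four or more factors, is kept here: it improves
`b² ≤ 1/2 + 1/(3 D)` to `(ε D)² ≤ 1/2 + 1/(4 D)`. Then `ε ≤ 3 / (4 D)`, the terms of order `1 / D`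
cancel exactly, and `1 / D²` gives strictness. -/
lemma epsConst_weight_lt_of_three {n : ℕ} (hn : 3 ≤ n) (hD : 8 ≤ D) :
    (epsConst n D * D / (1 - epsConst n D)) ^ 2 * (2 - 2 ^ 3 / (2 * D)) * 2 ^ 3 < 8 := by
  have hD2 : 2 ≤ D := by linarith
  have hD0 : 0 < D := by linarith
  have hβ : bSq n D ≤ (3 * D + 2) / (6 * D) := by
    refine (bSq_anti hD2 (by norm_num) hn).trans ?_
    have hden := bSq_den_pos hD2 3
    have hz : (2 * D - 1) ^ (((3 : ℕ) : ℤ) - 2) = 2 * D - 1 := by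
      norm_num
    rw [hz] at hden
    rw [bSq, hz, div_le_div_iff₀ hden (by positivity)]
    nlinarith [sq_nonneg D]
  have hβ0 := bSq_nonneg hD2 n
  have hβ' : bSq n D * (6 * D) ≤ 3 * D + 2 := by rwa [le_div_iff₀ (by positivity)] at hβ
  have hβ1 : bSq n D ≤ 1 := bSq_two hD2 ▸ bSq_anti hD2 one_le_two (by omega : 2 ≤ n)
  have hsq : (epsConst n D * D) ^ 2 ≤ 1 / 2 + 1 / (4 * D) := by
    have e : 1 / 2 + 1 / (4 * D) = (2 * D + 1) / (4 * D) := by field_simp; ring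
    rw [epsConst_mul_sq hD2 (by linarith), e, div_le_div_iff₀ (by linarith) (by positivity)]
    have h2 : (3 * D + 2) * (4 * D ^ 2 - 2 * D + 1) ≤ 6 * D ^ 2 * (2 * D + 1) := by nlinarith
    have h3 : bSq n D * (6 * D) * (4 * D ^ 2 - 2 * D + 1)
        ≤ (3 * D + 2) * (4 * D ^ 2 - 2 * D + 1) := by
      have : 0 ≤ 4 * D ^ 2 - 2 * D + 1 := by nlinarith
      gcongr
    have h4 : D * (bSq n D * (4 * D ^ 2 - 2 * D + 1)) ≤ D * (D * (2 * D + 1)) := by linarith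
    have h5 := le_of_mul_le_mul_left h4 hD0
    linarith
  set t := 1 / D with ht
  have ht0 : 0 < t := by positivity
  have ht8 : t ≤ 1 / 8 := one_div_le_one_div_of_le (by norm_num) hD
  have e1 : 1 / (4 * D) = t / 4 := by rw [ht]; field_simp
  have e2 : (2 : ℝ) ^ 3 / (2 * D) = 4 * t := by rw [ht]; field_simp; norm_num
  rw [e1] at hsq
  have hle : epsConst n D * D ≤ 3 / 4 :=
    abs_le_of_sq_le_sq' (by linarith : (epsConst n D * D) ^ 2 ≤ (3 / 4) ^ 2) (by norm_num) |>.2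
  have hε : epsConst n D ≤ 3 / 4 * t := by
    rw [ht, mul_one_div, le_div_iff₀ hD0]; exact hle
  rw [mul_assoc, e2]
  refine weight_lt_of_linear (by linarith) ?_
  nlinarith

end constants

/-! ### Separable mixtures with the stated constant -/

section mixing

variable {n : ℕ} {d : Fin n → ℕ}

lemma one_le_of_two_le_prod (h : 2 ≤ ∏ i, d i) (i : Fin n) : 1 ≤ d i := by
  by_contra h0
  have : ∏ i, d i = 0 := Finset.prod_eq_zero (Finset.mem_univ i) (by omega)
  omega

lemma nontrivialCount_pos (h : 2 ≤ ∏ i, d i) : 1 ≤ nontrivialCount d := by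
  by_contra h0
  have h1 : nontrivialCount d = 0 := by omega
  rw [nontrivialCount, Finset.card_eq_zero, Finset.filter_eq_empty_iff] at h1
  have : ∏ i, d i = 1 := Finset.prod_eq_one fun i _ => by
    have := h1 (Finset.mem_univ i)
    have := one_le_of_two_le_prod h i
    omega
  omega

lemma mixesSeparably_epsConst (h : 2 ≤ ∏ i, d i) :
    MixesSeparably d (epsConst n ((∏ i, d i : ℕ) : ℝ)) := by
  have hd := one_le_of_two_le_prod h
  have hD : (2 : ℝ) ≤ ((∏ i, d i : ℕ) : ℝ) := by exact_mod_cast h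
  have hm1 := nontrivialCount_pos h
  have hmn := nontrivialCount_le d
  have hpow : (2 : ℝ) ^ nontrivialCount d ≤ ((∏ i, d i : ℕ) : ℝ) := by
    exact_mod_cast two_pow_nontrivialCount_le hd
  have h0 := epsConst_nonneg hD n
  have hle := epsConst_le_one hD (hm1.trans hmn)
  rcases (by omega : nontrivialCount d ≤ 1 ∨ nontrivialCount d = 2 ∨ 3 ≤ nontrivialCount d)
    with hm | hm | hm
  · exact mixesSeparably_of_count_le_one hd hm h0 hle
  · exact mixesSeparably_of_count_eq_two hd hm h0 (epsConst_lt hD (by omega))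
  · refine mixesSeparably_of_three_le_count hd hm ?_ ?_
    · have := epsConst_mul_le_one hD (by omega : 2 ≤ n)
      nlinarith
    · rcases hm.eq_or_lt with h3 | h4
      · rw [← h3] at hpow ⊢
        exact epsConst_weight_lt_of_three (by omega) (by linarith)
      · exact epsConst_weight_lt_of_four_le h4 hmn hpow

end mixing

/-! ### Volumes of joint numerical ranges -/

section volume

/-- A translate of the direction space carries the set isometrically, and there the measure is
Lebesgue volume. A convex set spanning the space has interior points, and a bounded one has finite
volume. Both facts are needed to divide by `vol L`. -/
lemma euclideanHausdorffMeasure_pos_lt_top {E : Type*} [NormedAddCommGroup E]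
    [InnerProductSpace ℝ E] [FiniteDimensional ℝ E] [MeasurableSpace E] [BorelSpace E] {s : Set E}
    (hc : Convex ℝ s) (hne : s.Nonempty) (hb : Bornology.IsBounded s) :
    0 < μHE[Module.finrank ℝ (vectorSpan ℝ s)] s ∧ μHE[Module.finrank ℝ (vectorSpan ℝ s)] s < ⊤ := by
  obtain ⟨p, hp⟩ := hne
  set W := vectorSpan ℝ s with hW
  let f : W →ᵃ[ℝ] E := W.subtype.toAffineMap + AffineMap.const ℝ W p
  have hf : ∀ w : W, f w = w + p := fun w => rfl
  have hiso : Isometry f := Isometry.of_dist_eq fun x y => by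
    rw [hf, hf, dist_add_right]; rfl
  have himg : f '' (f ⁻¹' s) = s := by
    refine Set.image_preimage_eq_of_subset fun x hx => ?_
    exact ⟨⟨x - p, vsub_mem_vectorSpan ℝ hx hp⟩, by simp [hf]⟩
  have hspan : affineSpan ℝ (f ⁻¹' s) = ⊤ := by
    rw [AffineSubspace.affineSpan_eq_top_iff_vectorSpan_eq_top_of_nonempty]
    · have h1 := f.map_vectorSpan (s := f ⁻¹' s)
      rw [himg, ← hW] at h1
      have h2 : f.linear = W.subtype := by
        ext w
        simp [f]
      rw [h2] at h1
      refine Submodule.map_injective_of_injective W.injective_subtype ?_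
      rw [h1, Submodule.map_subtype_top]
    · exact ⟨0, by simpa [hf] using hp⟩
  have hconv : Convex ℝ (f ⁻¹' s) := hc.affine_preimage f
  have hbdd : Bornology.IsBounded (f ⁻¹' s) := hiso.antilipschitz.isBounded_preimage hb
  rw [← himg, hiso.euclideanHausdorffMeasure_image,
    InnerProductSpace.euclideanHausdorffMeasure_eq_volume]
  refine ⟨?_, hbdd.measure_lt_top⟩
  exact Measure.measure_pos_of_nonempty_interior _
    (hconv.interior_nonempty_iff_affineSpan_eq_top.2 hspan)

variable {ι : Type*} [Fintype ι] {k : ℕ}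

/-- The joint expectation values of observables as a linear map. -/
def expectation (A : Fin k → Matrix ι ι ℂ) : Matrix ι ι ℂ →ₗ[ℝ] EuclideanSpace ℝ (Fin k) where
  toFun ρ := WithLp.toLp 2 fun j => (ρ * A j).trace.re
  map_add' ρ σ := by
    ext j; simp [add_mul, Matrix.trace_add]
  map_smul' c ρ := by
    ext j; simp [Matrix.trace_smul]

lemma convex_states : Convex ℝ (states ι) := by
  intro ρ hρ σ hσ a b ha hb hab
  refine ⟨(hρ.1.smul ha).add (hσ.1.smul hb), ?_⟩
  rw [Matrix.trace_add, Matrix.trace_smul, Matrix.trace_smul, hρ.2, hσ.2, ← add_smul, hab, one_smul]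

lemma norm_apply_le_one {ρ : Matrix ι ι ℂ} (hρ : ρ ∈ states ι) (x y : ι) : ‖ρ x y‖ ≤ 1 := by
  obtain ⟨m, v, hv, htr⟩ := exists_pure_decomposition hρ
  rw [hv, Matrix.sum_apply, ← htr]
  refine (norm_sum_le _ _).trans (Finset.sum_le_sum fun k _ => ?_)
  have hle : ∀ z, ‖v k z‖ ^ 2 ≤ ∑ x, ‖v k x‖ ^ 2 := fun z =>
    Finset.single_le_sum (f := fun x => ‖v k x‖ ^ 2) (fun _ _ => by positivity)
      (Finset.mem_univ z)
  rw [vecMulVec_apply, norm_mul, Pi.star_apply, norm_star]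
  nlinarith [hle x, hle y, sq_nonneg (‖v k x‖ - ‖v k y‖)]

lemma isBounded_numRange_states (A : Fin k → Matrix ι ι ℂ) :
    Bornology.IsBounded (numRange (states ι) A) := by
  rw [isBounded_iff_forall_norm_le]
  refine ⟨√(∑ j, (∑ x, ∑ y, ‖A j y x‖) ^ 2), ?_⟩
  rintro _ ⟨ρ, hρ, rfl⟩
  rw [EuclideanSpace.norm_eq]
  refine Real.sqrt_le_sqrt (Finset.sum_le_sum fun j _ => ?_)
  have h : ‖(ρ * A j).trace.re‖ ≤ ∑ x, ∑ y, ‖A j y x‖ := by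
    refine (Complex.abs_re_le_norm _).trans ?_
    rw [Matrix.trace]
    refine (norm_sum_le _ _).trans (Finset.sum_le_sum fun x _ => ?_)
    rw [Matrix.diag_apply, Matrix.mul_apply]
    refine (norm_sum_le _ _).trans (Finset.sum_le_sum fun y _ => ?_)
    rw [norm_mul]
    exact mul_le_of_le_one_left (norm_nonneg _) (norm_apply_le_one hρ x y)
  exact pow_le_pow_left₀ (norm_nonneg _) h 2

open scoped MatrixOrder in
lemma eq_zero_of_trace_pure_eq_zero {C : Matrix ι ι ℂ} (hC : C.IsHermitian)
    (h : ∀ v : ι → ℂ, (vecMulVec v (star v) * C).trace.re = 0) : C = 0 := by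
  have h0 : ∀ v : ι → ℂ, star v ⬝ᵥ C *ᵥ v = 0 := fun v => by
    refine Complex.ext ?_ (hC.im_star_dotProduct_mulVec_self v)
    have := h v
    rwa [vecMulVec_mul, Matrix.trace_vecMulVec, dotProduct_comm, ← dotProduct_mulVec] at this
  refine le_antisymm ?_ ?_
  · rw [Matrix.le_iff, zero_sub]
    exact PosSemidef.of_dotProduct_mulVec_nonneg hC.neg fun v => by
      rw [Matrix.neg_mulVec, dotProduct_neg, h0, neg_zero]
  · rw [Matrix.nonneg_iff_posSemidef]
    exact PosSemidef.of_dotProduct_mulVec_nonneg hC fun v => (h0 v).ge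

variable [DecidableEq ι]

lemma maximallyMixed_mem [Nonempty ι] :
    ((Fintype.card ι : ℝ)⁻¹ • (1 : Matrix ι ι ℂ)) ∈ states ι := by
  refine ⟨PosSemidef.one.smul (by positivity), ?_⟩
  rw [Matrix.trace_smul, Matrix.trace_one]
  have : (Fintype.card ι : ℂ) ≠ 0 := by exact_mod_cast Fintype.card_ne_zero
  simp [this]

/-- A vector `u` orthogonal to the span gives a traceless Hermitian `C`, the combination of the
traceless parts with coefficients `u`. Its expectation in every state equals that in the maximally
mixed one, namely `0`. Hence `C = 0`, and independence gives `u = 0`. -/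
lemma vectorSpan_numRange_eq_top [Nonempty ι] {A : Fin k → Matrix ι ι ℂ}
    (hA : ∀ j, (A j).IsHermitian) (hind : Independent A) :
    vectorSpan ℝ (numRange (states ι) A) = ⊤ := by
  rw [← Submodule.orthogonal_eq_bot_iff, Submodule.eq_bot_iff]
  intro u hu
  have hcard : (Fintype.card ι : ℂ) ≠ 0 := by exact_mod_cast Fintype.card_ne_zero
  set C : Matrix ι ι ℂ :=
    ∑ j, u j • (A j - ((A j).trace / (Fintype.card ι : ℂ)) • (1 : Matrix ι ι ℂ)) with hC
  have htrre : ∀ j, star (A j).trace = (A j).trace := fun j => by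
    rw [← Matrix.trace_conjTranspose, hA j]
  have hCh : C.IsHermitian := by
    rw [hC, IsHermitian, Matrix.conjTranspose_sum]
    refine Finset.sum_congr rfl fun j _ => ?_
    rw [Matrix.conjTranspose_smul, Matrix.conjTranspose_sub, Matrix.conjTranspose_smul,
      Matrix.conjTranspose_one, hA j, star_div₀, htrre]
    simp
  have htrC : C.trace = 0 := by
    rw [hC, Matrix.trace_sum]
    refine Finset.sum_eq_zero fun j _ => ?_
    rw [Matrix.trace_smul, Matrix.trace_sub, Matrix.trace_smul, Matrix.trace_one, smul_eq_mul,
      div_mul_cancel₀ _ hcard, sub_self, smul_zero]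
  have hstate : ∀ ρ ∈ states ι, (ρ * C).trace.re = 0 := by
    intro ρ hρ
    have hdiff := (Submodule.mem_orthogonal' _ _).1 hu _
      (vsub_mem_vectorSpan ℝ (Set.mem_image_of_mem (expectation A) hρ)
        (Set.mem_image_of_mem (expectation A) (maximallyMixed_mem (ι := ι))))
    rw [vsub_eq_sub, ← map_sub, PiLp.inner_apply] at hdiff
    have h1 : ∀ σ : Matrix ι ι ℂ, σ.trace = 0 →
        (σ * C).trace.re = ∑ j, inner ℝ (u j) (expectation A σ j) := by
      intro σ hσ
      rw [hC, Finset.mul_sum, Matrix.trace_sum, Complex.re_sum]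
      refine Finset.sum_congr rfl fun j _ => ?_
      rw [mul_smul_comm, Matrix.trace_smul, mul_sub, mul_smul_comm, mul_one, Matrix.trace_sub,
        Matrix.trace_smul, hσ, smul_zero, sub_zero]
      simp [expectation, mul_comm]
    have h2 : (ρ - (Fintype.card ι : ℝ)⁻¹ • (1 : Matrix ι ι ℂ)).trace = 0 := by
      rw [Matrix.trace_sub, hρ.2, (maximallyMixed_mem (ι := ι)).2, sub_self]
    rw [← h1 _ h2, sub_mul, Matrix.trace_sub, smul_mul_assoc, one_mul, Matrix.trace_smul, htrC,
      smul_zero, sub_zero] at hdiff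
    exact hdiff
  have hC0 : C = 0 := by
    refine eq_zero_of_trace_pure_eq_zero hCh fun v => ?_
    rcases (Finset.sum_nonneg fun x _ => by positivity : 0 ≤ ∑ x, ‖v x‖ ^ 2).eq_or_lt with h0 | h0
    · have hz : v = 0 := by
        ext x
        have := (Finset.sum_eq_zero_iff_of_nonneg (fun _ _ => by positivity)).1 h0.symm x
          (Finset.mem_univ x)
        simpa using this
      simp [hz]
    · have := hstate ((∑ x, ‖v x‖ ^ 2)⁻¹ • vecMulVec v (star v))
        ⟨(posSemidef_vecMulVec_self_star v).smul (inv_nonneg.2 h0.le), by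
          rw [Matrix.trace_smul, trace_pure, Complex.real_smul, ← Complex.ofReal_mul,
            inv_mul_cancel₀ h0.ne', Complex.ofReal_one]⟩
      rw [smul_mul_assoc, Matrix.trace_smul, Complex.smul_re, smul_eq_mul] at this
      exact (mul_eq_zero.1 this).resolve_left (inv_ne_zero h0.ne')
  have := Fintype.linearIndependent_iff.1 hind (fun j => u j) hC0
  ext j
  simpa using this j

end volume

/-! ### Volume ratios from homothetic copies -/

section ratio

variable {n k : ℕ} {d : Fin n → ℕ}

lemma MixesSeparably.le_relVolRatio {ε : ℝ} (h : MixesSeparably d ε) (h0 : 0 < ε) (h1 : ε ≤ 1)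
    (hd : ∀ i, 1 ≤ d i) (A : Fin k → Matrix (Idx d) (Idx d) ℂ) :
    ENNReal.ofReal (ε ^ k) ≤ relVolRatio A := by
  have hne : Nonempty (Idx d) := ⟨fun i => ⟨0, hd i⟩⟩
  have hcard : ((Fintype.card (Idx d) : ℕ) : ℝ) = ((∏ i, d i : ℕ) : ℝ) := by
    rw [Fintype.card_pi]; simp
  have hmix := maximallyMixed_mem (ι := Idx d)
  set X := numRange (states (Idx d)) A with hX
  obtain ⟨hpos, hfin⟩ := euclideanHausdorffMeasure_pos_lt_top (s := X)
    (convex_states.linear_image (expectation A)) ⟨_, Set.mem_image_of_mem _ hmix⟩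
    (isBounded_numRange_states A)
  unfold relVolRatio
  simp only [← hX]
  set m := Module.finrank ℝ (vectorSpan ℝ X) with hm
  have hmk : m ≤ k := (Submodule.finrank_le _).trans (by simp)
  rw [ENNReal.le_div_iff_mul_le (Or.inl hpos.ne') (Or.inl hfin.ne)]
  set c := expectation A ((Fintype.card (Idx d) : ℝ)⁻¹ • 1) with hc
  have hsub : AffineMap.homothety c ε '' X ⊆ numRange (sepStates d) A := by
    rintro _ ⟨_, ⟨ρ, hρ, rfl⟩, rfl⟩
    refine ⟨_, h ρ hρ, ?_⟩
    change expectation A _ = AffineMap.homothety c ε (expectation A ρ)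
    rw [AffineMap.homothety_apply, hc, vsub_eq_sub, vadd_eq_add, hcard, ← map_sub, ← map_smul,
      ← map_add]
    congr 1
    rw [div_eq_mul_inv]
    module
  calc ENNReal.ofReal (ε ^ k) * μHE[m] X ≤ ENNReal.ofReal (ε ^ m) * μHE[m] X := by
        gcongr ENNReal.ofReal ?_ * _
        exact pow_le_pow_of_le_one h0.le h1 hmk
    _ = μHE[m] (AffineMap.homothety c ε '' X) := by
        rw [euclideanHausdorffMeasure_homothety_image _ _ h0.ne', ENNReal.smul_def, smul_eq_mul]
        congr 1
        rw [ENNReal.coe_pow, ENNReal.ofReal_pow h0.le, ← enorm_eq_nnnorm, Real.enorm_of_nonneg h0.le]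
    _ ≤ _ := measure_mono hsub

lemma relVolRatio_eq_volRatio (hd : ∀ i, 1 ≤ d i) {A : Fin k → Matrix (Idx d) (Idx d) ℂ}
    (hA : ∀ j, (A j).IsHermitian) (hind : Independent A) : relVolRatio A = volRatio A := by
  have hne : Nonempty (Idx d) := ⟨fun i => ⟨0, hd i⟩⟩
  have hm : Module.finrank ℝ (vectorSpan ℝ (numRange (states (Idx d)) A)) = k := by
    rw [vectorSpan_numRange_eq_top hA hind, finrank_top, finrank_euclideanSpace_fin]
  simp only [relVolRatio, volRatio, hm, EuclideanSpace.euclideanHausdorffMeasure_eq_volume]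

lemma le_minVolRatio (hd : ∀ i, 1 ≤ d i) {r : ENNReal}
    (h : ∀ A : Fin k → Matrix (Idx d) (Idx d) ℂ, r ≤ relVolRatio A) : r ≤ minVolRatio d k := by
  refine le_sInf ?_
  rintro _ ⟨A, hA, hind, rfl⟩
  rw [← relVolRatio_eq_volRatio hd hA hind]
  exact h A

lemma epsConst_pow_le_relVolRatio (h : 2 ≤ ∏ i, d i) (A : Fin k → Matrix (Idx d) (Idx d) ℂ) :
    ENNReal.ofReal (epsConst n ((∏ i, d i : ℕ) : ℝ) ^ k) ≤ relVolRatio A := by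
  have hD : (2 : ℝ) ≤ ((∏ i, d i : ℕ) : ℝ) := by exact_mod_cast h
  have hn : 1 ≤ n := (nontrivialCount_pos h).trans (nontrivialCount_le d)
  exact (mixesSeparably_epsConst h).le_relVolRatio (epsConst_pos hD hn) (epsConst_le_one hD hn)
    (one_le_of_two_le_prod h) A

lemma bipartite_le_relVolRatio {d : ℕ} (hd : 2 ≤ d)
    (A : Fin k → Matrix (Idx fun _ : Fin 2 => d) (Idx fun _ : Fin 2 => d) ℂ) :
    ENNReal.ofReal (1 / ((d : ℝ) ^ 2 - 1) ^ k) ≤ relVolRatio A := by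
  have hd' : (2 : ℝ) ≤ d := by exact_mod_cast hd
  have hprod : ((∏ _i : Fin 2, d : ℕ) : ℝ) = (d : ℝ) ^ 2 := by simp
  have hcount : nontrivialCount (fun _ : Fin 2 => d) = 2 := by simp [nontrivialCount, hd]
  set u := 1 / ((d : ℝ) ^ 2 - 1) with hu
  have hden : 0 < (d : ℝ) ^ 2 - 1 := by nlinarith
  have hu0 : 0 < u := by positivity
  have hu1 : u ≤ 1 := by rw [hu, div_le_one hden]; nlinarith
  rw [← _root_.one_div_pow, ← hu]
  -- Only weights strictly below `1 / (d² - 1)` are known to mix separably; the bound at the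
  -- endpoint follows by continuity of `ε ^ k`.
  have hlim : Filter.Tendsto (fun ε : ℝ => ENNReal.ofReal (ε ^ k)) (nhdsWithin u (Set.Iio u))
      (nhds (ENNReal.ofReal (u ^ k))) :=
    ((ENNReal.continuous_ofReal.comp (continuous_pow k)).tendsto u).mono_left nhdsWithin_le_nhds
  refine le_of_tendsto hlim ?_
  filter_upwards [Ioo_mem_nhdsLT hu0] with ε hε
  have hmix : MixesSeparably (fun _ : Fin 2 => d) ε :=
    mixesSeparably_of_count_eq_two (fun _ => by omega) hcount hε.1.le (by rw [hprod]; exact hε.2)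
  exact hmix.le_relVolRatio hε.1 (hε.2.le.trans hu1) (fun _ => by omega) A

end ratio

end SepNumRange

end

/-- The lower bounds hold for the minimum over independent observables and, with the relative
volume inside the affine span, for arbitrary (possibly dependent) observables. -/
theorem theorem1 :
    (∀ (n : ℕ) (d : Fin n → ℕ) (k : ℕ), 2 ≤ ∏ i, d i →
      ENNReal.ofReal (SepNumRange.epsConst n ((∏ i, d i : ℕ) : ℝ) ^ k) ≤
        SepNumRange.minVolRatio d k ∧
      ∀ A : Fin k → Matrix (SepNumRange.Idx d) (SepNumRange.Idx d) ℂ,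
        (∀ j, (A j).IsHermitian) →
          ENNReal.ofReal (SepNumRange.epsConst n ((∏ i, d i : ℕ) : ℝ) ^ k) ≤
            SepNumRange.relVolRatio A) ∧
    (∀ (d k : ℕ), 2 ≤ d →
      ENNReal.ofReal (1 / ((d : ℝ) ^ 2 - 1) ^ k) ≤
        SepNumRange.minVolRatio (fun _ : Fin 2 => d) k ∧
      ∀ A : Fin k → Matrix (SepNumRange.Idx fun _ : Fin 2 => d)
          (SepNumRange.Idx fun _ : Fin 2 => d) ℂ,
        (∀ j, (A j).IsHermitian) →
          ENNReal.ofReal (1 / ((d : ℝ) ^ 2 - 1) ^ k) ≤ SepNumRange.relVolRatio A) := by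
  refine ⟨fun n d k h => ⟨?_, fun A _ => SepNumRange.epsConst_pow_le_relVolRatio h A⟩,
    fun d k h => ⟨?_, fun A _ => SepNumRange.bipartite_le_relVolRatio h A⟩⟩
  · exact SepNumRange.le_minVolRatio (SepNumRange.one_le_of_two_le_prod h)
      (SepNumRange.epsConst_pow_le_relVolRatio h)
  · exact SepNumRange.le_minVolRatio (fun _ => by omega) (SepNumRange.bipartite_le_relVolRatio h)
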